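/- Let $N$ be a smooth $2$-manifold and let $\phi\colon N\to\mathbb R^3$ be an elliptic or hyperbolic affine sphere with centre at the origin, scaled so that the absolute value of its mean curvature is $1$; that is, $\phi$ is a nondegenerate immersion whose affine (Blaschke) normal is $-\epsilon\phi$ and whose affine shape operator is $\epsilon\,\mathrm{id}$, with $\epsilon=1$ (elliptic) or $\epsilon=-1$ (hyperbolic). Let $I\subset\mathbb R$ be an open interval and $\gamma=(\gamma_1,\gamma_2)\colon I\to\mathbb R^2$ a smooth curve such that $$F\colon I\times N\to\mathbb R\times\mathbb R^3=\mathbb R^4,\qquad F(t,x)=(\gamma_1(t),\gamma_2(t)\,\phi(x)),$$ defines a positive definite affine hypersurface, i.e. $F$ is an immersion with an affine normal $\xi$ whose affine metric $h$ is positive definite. Here the affine normal, the induced connection $\nabla$, the affine metric $h$ and the affine shape operator $S$ are given by $D_XY=\nabla_XY+h(X,Y)\xi$, $D_X\xi=-SX$ and the requirement that the volume form $\det(\cdot,\cdot,\cdot,\xi)$ agrees, up to orientation, with the volume form of $h$; the difference tensor is $K=\nabla-\widehat\nabla$ with $\widehat\nabla$ the Levi-Civita connection of $h$. Then $F$ admits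 a pointwise $Z_3$-symmetry or a pointwise $SO(2)$-symmetry. Here, for a subgroup $G\subset SO(3)$, $F$ is said to admit a pointwise $G$-symmetry if at every point $p$ there is an $h$-orthonormal basis of the tangent space at $p$ through which $G$ acts on that tangent space by automorphisms preserving $h$, $K$ and $S$ at $p$; $SO(2)$ is the group of all rotations about the first axis, and $Z_3$ is its subgroup generated by the rotation by the angle $2\pi/3$. -/

import Mathlib

open scoped Manifold ContDiff

noncomputable section

namespace AffineHypersurface

/-! ### Affine invariants in a coordinate patch

`E` is the coordinate space (of dimension `n`), `f : E → ℝⁿ⁺¹` a parametrized hypersurface and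
`ξ : E → ℝⁿ⁺¹` a vector field along it. Constant vectors `u v : E` play the role of coordinate
vector fields, so that `D_u (f_* v) = D²f(u, v)`. -/

section Local

variable {E : Type*} [NormedAddCommGroup E] [NormedSpace ℝ E] {n : ℕ}

/-- The map `(v, s) ↦ f_* v + s ξ`; it is invertible iff `f` is an immersion at `x` and `ξ x` is
transversal to it. -/
def frameMap (f ξ : E → (Fin (n + 1) → ℝ)) (x : E) : (E × ℝ) →L[ℝ] (Fin (n + 1) → ℝ) :=
  (fderiv ℝ f x).coprod (ContinuousLinearMap.toSpanSingleton ℝ (ξ x))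

/-- The tangential component of a vector, pulled back to `E` by `f_*`. -/
def tangentialPart (f ξ : E → (Fin (n + 1) → ℝ)) (x : E) : (Fin (n + 1) → ℝ) →L[ℝ] E :=
  (ContinuousLinearMap.fst ℝ E ℝ).comp (frameMap f ξ x).inverse

/-- The `ξ`-component of a vector. -/
def transversalPart (f ξ : E → (Fin (n + 1) → ℝ)) (x : E) : (Fin (n + 1) → ℝ) →L[ℝ] ℝ :=
  (ContinuousLinearMap.snd ℝ E ℝ).comp (frameMap f ξ x).inverse

/-- Christoffel form of the induced connection `∇`: the tangential part of `D_u (f_* v)`. -/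
def inducedConnection (f ξ : E → (Fin (n + 1) → ℝ)) (x : E) : E →L[ℝ] E →L[ℝ] E :=
  (ContinuousLinearMap.compL ℝ E (Fin (n + 1) → ℝ) E (tangentialPart f ξ x)).comp
    (fderiv ℝ (fderiv ℝ f) x)

/-- The affine metric `h`: the `ξ`-part of `D_u (f_* v)`. -/
def affineMetric (f ξ : E → (Fin (n + 1) → ℝ)) (x : E) : E →L[ℝ] E →L[ℝ] ℝ :=
  (ContinuousLinearMap.compL ℝ E (Fin (n + 1) → ℝ) ℝ (transversalPart f ξ x)).comp
    (fderiv ℝ (fderiv ℝ f) x)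

/-- The affine shape operator `S`, from `D_u ξ = - f_* (S u)`. -/
def shapeOperator (f ξ : E → (Fin (n + 1) → ℝ)) (x : E) : E →L[ℝ] E :=
  -((tangentialPart f ξ x).comp (fderiv ℝ ξ x))

/-- Christoffel form of the Levi-Civita connection of a metric `g` given in coordinates:
`2 g(∇̂_u v, w) = ∂_u g(v, w) + ∂_v g(u, w) - ∂_w g(u, v)`. -/
def leviCivita (g : E → E →L[ℝ] E →L[ℝ] ℝ) (x u v : E) : E :=
  (g x).inverse ((1 / 2 : ℝ) •
    (fderiv ℝ g x u v + fderiv ℝ g x v u - ((fderiv ℝ g x).flip u).flip v))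

/-- The difference tensor `K(u, v) = ∇_u v - ∇̂_u v`. -/
def differenceTensor (f ξ : E → (Fin (n + 1) → ℝ)) (x u v : E) : E :=
  inducedConnection f ξ x u v - leviCivita (affineMetric f ξ) x u v

/-- The conditions for `f` to be a nondegenerate immersion at `x` with affine (Blaschke) normal
`ξ`: `ξ` is transversal, its derivatives are tangential, `h` is nondegenerate, and the volume form
`det(f_* ·, …, f_* ·, ξ)` agrees, up to orientation, with the volume form of `h`. -/
structure IsBlaschkeAt (f ξ : E → (Fin (n + 1) → ℝ)) (x : E) : Prop where
  transversal : (frameMap f ξ x).IsInvertible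
  equiaffine : ∀ u : E, transversalPart f ξ x (fderiv ℝ ξ x u) = 0
  nondegenerate : ∀ u : E, (∀ v : E, affineMetric f ξ x u v = 0) → u = 0
  volume : ∀ b : Module.Basis (Fin n) ℝ E,
    |(Matrix.of (Fin.snoc (fun i => fderiv ℝ f x (b i)) (ξ x) :
        Fin (n + 1) → Fin (n + 1) → ℝ)).det| =
      √|(Matrix.of fun i j => affineMetric f ξ x (b i) (b j)).det|

end Local

/-! ### Hypersurfaces parametrized by (open subsets of) manifolds

The conditions are imposed in the coordinates of the charts. The tangent space of `M` at `p` is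
the model space `E`, identified through the preferred chart at `p`. -/

section Global

variable {E : Type*} [NormedAddCommGroup E] [NormedSpace ℝ E] {H : Type*} [TopologicalSpace H]
  (I : ModelWithCorners ℝ E H) {M : Type*} [TopologicalSpace M] [ChartedSpace H M] {n : ℕ}

/-- A map on `M`, written in the preferred chart at `p`. -/
def inChart {W : Type*} (F : M → W) (p : M) : E → W := F ∘ (extChartAt I p).symm

/-- `F : Ω → ℝⁿ⁺¹` is a nondegenerate affine hypersurface with affine (Blaschke) normal `ξ`. -/
structure IsAffineHypersurface (F ξ : M → (Fin (n + 1) → ℝ)) (Ω : Set M) : Prop where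
  smooth : ContMDiffOn I 𝓘(ℝ, Fin (n + 1) → ℝ) ∞ F Ω
  smooth_normal : ContMDiffOn I 𝓘(ℝ, Fin (n + 1) → ℝ) ∞ ξ Ω
  blaschke : ∀ p : M, ∀ x ∈ (extChartAt I p).target, (extChartAt I p).symm x ∈ Ω →
    IsBlaschkeAt (inChart I F p) (inChart I ξ p) x

/-- `F : Ω → ℝⁿ⁺¹` is a positive definite affine hypersurface with affine normal `ξ`. -/
structure IsPositiveDefinite (F ξ : M → (Fin (n + 1) → ℝ)) (Ω : Set M) : Prop
    extends IsAffineHypersurface I F ξ Ω where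
  pos : ∀ p : M, ∀ x ∈ (extChartAt I p).target, (extChartAt I p).symm x ∈ Ω →
    ∀ u : E, u ≠ 0 → 0 < affineMetric (inChart I F p) (inChart I ξ p) x u u

/-- `φ : M → ℝⁿ⁺¹` is a proper affine sphere with affine normal `ξ`, mean curvature `c ≠ 0`
(that is, `S = c · id`) and centre `φ + c⁻¹ ξ` at the origin. It is elliptic if `c > 0` and
hyperbolic if `c < 0`. -/
structure IsProperAffineSphere (φ ξ : M → (Fin (n + 1) → ℝ)) (c : ℝ) : Prop
    extends IsAffineHypersurface I φ ξ Set.univ where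
  ne_zero : c ≠ 0
  shape : ∀ p : M, ∀ x ∈ (extChartAt I p).target,
    shapeOperator (inChart I φ p) (inChart I ξ p) x = c • ContinuousLinearMap.id ℝ E
  centre : ∀ p : M, φ p + c⁻¹ • ξ p = 0

/-- Pointwise `G`-symmetry of an affine hypersurface, for a subgroup `G` of `SO(n)`: at every point
`p` there is an `h`-orthonormal basis of the tangent space through which `G` acts as a group of
(orientation preserving) automorphisms that preserve `h`, `K` and `S` at `p`. -/
def AdmitsPointwiseSymmetry (F ξ : M → (Fin (n + 1) → ℝ)) (Ω : Set M)
    (G : Subgroup (Matrix.specialOrthogonalGroup (Fin n) ℝ)) : Prop :=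
  ∀ p ∈ Ω,
    let h := affineMetric (inChart I F p) (inChart I ξ p) (extChartAt I p p)
    let K := differenceTensor (inChart I F p) (inChart I ξ p) (extChartAt I p p)
    let S := shapeOperator (inChart I F p) (inChart I ξ p) (extChartAt I p p)
    ∃ e : Module.Basis (Fin n) ℝ E,
      (∀ i j, h (e i) (e j) = if i = j then 1 else 0) ∧
      ∀ g ∈ G, ∀ X Y : E,
        h (Matrix.toLin e e g.1 X) (Matrix.toLin e e g.1 Y) = h X Y ∧
        K (Matrix.toLin e e g.1 X) (Matrix.toLin e e g.1 Y) = Matrix.toLin e e g.1 (K X Y) ∧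
        S (Matrix.toLin e e g.1 X) = Matrix.toLin e e g.1 (S X)

end Global

/-! ### The groups `SO(2)` and `Z₃` inside `SO(3)` -/

/-- The rotation by the angle `θ` about the first coordinate axis. -/
def rotation (θ : ℝ) : Matrix.specialOrthogonalGroup (Fin 3) ℝ :=
  ⟨!![1, 0, 0; 0, Real.cos θ, -Real.sin θ; 0, Real.sin θ, Real.cos θ], by
    rw [Matrix.mem_specialOrthogonalGroup_iff, Matrix.mem_orthogonalGroup_iff]
    have h := Real.sin_sq_add_cos_sq θ
    refine ⟨?_, ?_⟩
    · ext i j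
      fin_cases i <;> fin_cases j <;>
        simp [Matrix.mul_apply, Fin.sum_univ_three] <;> linarith
    · simp [Matrix.det_fin_three]
      linarith⟩

/-- `SO(2)`: all rotations about the first axis. -/
def groupSO2 : Subgroup (Matrix.specialOrthogonalGroup (Fin 3) ℝ) :=
  Subgroup.closure (Set.range rotation)

/-- `Z₃`: generated by the rotation by `2π/3` about the first axis. -/
def groupZ3 : Subgroup (Matrix.specialOrthogonalGroup (Fin 3) ℝ) :=
  Subgroup.zpowers (rotation (2 * Real.pi / 3))

end AffineHypersurface

end

namespace AffineHypersurface

open Filter Topology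

section Frame

variable {E : Type*} [NormedAddCommGroup E] [NormedSpace ℝ E] {n : ℕ}
  {f ξ : E → (Fin (n + 1) → ℝ)} {x : E}

theorem frameMap_apply (u : E) (s : ℝ) :
    frameMap f ξ x (u, s) = fderiv ℝ f x u + s • ξ x := by
  simp [frameMap]

theorem frameMap_inverse_fderiv (h : (frameMap f ξ x).IsInvertible) (u : E) :
    (frameMap f ξ x).inverse (fderiv ℝ f x u) = (u, 0) := by
  rw [← h.inverse_apply_self (u, 0), frameMap_apply]
  simp

theorem frameMap_inverse_normal (h : (frameMap f ξ x).IsInvertible) :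
    (frameMap f ξ x).inverse (ξ x) = (0, 1) := by
  rw [← h.inverse_apply_self (0, 1), frameMap_apply]
  simp

theorem transversalPart_fderiv (h : (frameMap f ξ x).IsInvertible) (u : E) :
    transversalPart f ξ x (fderiv ℝ f x u) = 0 := by
  simp [transversalPart, frameMap_inverse_fderiv h]

theorem transversalPart_normal (h : (frameMap f ξ x).IsInvertible) :
    transversalPart f ξ x (ξ x) = 1 := by
  simp [transversalPart, frameMap_inverse_normal h]

theorem tangentialPart_fderiv (h : (frameMap f ξ x).IsInvertible) (u : E) :
    tangentialPart f ξ x (fderiv ℝ f x u) = u := by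
  simp [tangentialPart, frameMap_inverse_fderiv h]

theorem tangentialPart_normal (h : (frameMap f ξ x).IsInvertible) :
    tangentialPart f ξ x (ξ x) = 0 := by
  simp [tangentialPart, frameMap_inverse_normal h]

theorem frame_decomposition (h : (frameMap f ξ x).IsInvertible) (w : Fin (n + 1) → ℝ) :
    fderiv ℝ f x (tangentialPart f ξ x w) + transversalPart f ξ x w • ξ x = w := by
  have := h.self_apply_inverse w
  rw [← frameMap_apply]
  exact this

theorem affineMetric_apply (u v : E) :
    affineMetric f ξ x u v = transversalPart f ξ x (fderiv ℝ (fderiv ℝ f) x u v) := by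
  simp [affineMetric]

theorem inducedConnection_apply (u v : E) :
    inducedConnection f ξ x u v = tangentialPart f ξ x (fderiv ℝ (fderiv ℝ f) x u v) := by
  simp [inducedConnection]

/-- The matrix whose rows are a tangent basis followed by the transversal field. -/
noncomputable def frameMatrix (f ξ : E → (Fin (n + 1) → ℝ)) (b : Module.Basis (Fin n) ℝ E) (x : E) :
    Matrix (Fin (n + 1)) (Fin (n + 1)) ℝ :=
  Matrix.of (Fin.snoc (fun i => fderiv ℝ f x (b i)) (ξ x) : Fin (n + 1) → Fin (n + 1) → ℝ)

theorem det_updateRow_frameMatrix (h : (frameMap f ξ x).IsInvertible)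
    (b : Module.Basis (Fin n) ℝ E) (k : Fin (n + 1)) (w : Fin (n + 1) → ℝ) :
    ((frameMatrix f ξ b x).updateRow k w).det =
      (Fin.snoc (fun i => b.repr (tangentialPart f ξ x w) i) (transversalPart f ξ x w) :
        Fin (n + 1) → ℝ) k * (frameMatrix f ξ b x).det := by
  have key := Matrix.det_updateRow_sum (frameMatrix f ξ b x) k
    (Fin.snoc (fun i => b.repr (tangentialPart f ξ x w) i) (transversalPart f ξ x w))
  have hw : ∑ k, (Fin.snoc (fun i => b.repr (tangentialPart f ξ x w) i)
      (transversalPart f ξ x w) : Fin (n + 1) → ℝ) k • frameMatrix f ξ b x k = w := by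
    rw [Fin.sum_univ_castSucc]
    have e1 : ∀ i, frameMatrix f ξ b x (Fin.castSucc i) = fderiv ℝ f x (b i) := fun i => by
      ext j
      simp [frameMatrix]
    have e2 : frameMatrix f ξ b x (Fin.last n) = ξ x := by
      ext j
      simp [frameMatrix]
    simp only [Fin.snoc_castSucc, Fin.snoc_last, e1, e2]
    conv_rhs => rw [← frame_decomposition h w, ← b.sum_repr (tangentialPart f ξ x w), map_sum]
    simp only [map_smul]
  rwa [hw, smul_eq_mul] at key

/-- The volume form of the ambient space, evaluated on a tangent basis and an arbitrary vector. -/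
theorem det_snoc_eq (h : (frameMap f ξ x).IsInvertible) (b : Module.Basis (Fin n) ℝ E)
    (w : Fin (n + 1) → ℝ) :
    (Matrix.of (Fin.snoc (fun i => fderiv ℝ f x (b i)) w :
        Fin (n + 1) → Fin (n + 1) → ℝ)).det =
      transversalPart f ξ x w * (frameMatrix f ξ b x).det := by
  have key := det_updateRow_frameMatrix h b (Fin.last n) w
  rw [Fin.snoc_last] at key
  rw [← key]
  congr 1
  ext i j
  refine Fin.lastCases ?_ (fun i => ?_) i
  · simp
  · simp [Matrix.updateRow_apply, frameMatrix, (Fin.castSucc_lt_last i).ne]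

end Frame

section DetDeriv

variable {E : Type*} [NormedAddCommGroup E] [NormedSpace ℝ E]
  {ι : Type*} [Fintype ι] [DecidableEq ι]

/-- Jacobi's formula, row by row. -/
theorem fderiv_det_eq_sum {A : E → ι → ι → ℝ} {A' : ι → E →L[ℝ] (ι → ℝ)} {x : E}
    (h : ∀ i, HasFDerivAt (fun y => A y i) (A' i) x) :
    ∃ L : E →L[ℝ] ℝ, HasFDerivAt (fun y => (Matrix.of (A y)).det) L x ∧
      ∀ u, L u = ∑ i, ((Matrix.of (A x)).updateRow i (A' i u)).det := by
  let D : ContinuousMultilinearMap ℝ (fun _ : ι => ι → ℝ) ℝ :=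
    ⟨(Matrix.detRowAlternating (n := ι) (R := ℝ)).toMultilinearMap, by
      change Continuous fun M : Matrix ι ι ℝ => M.det
      exact Continuous.matrix_det continuous_id⟩
  refine ⟨_, HasFDerivAt.multilinear_comp D h, fun u => ?_⟩
  simp only [sum_apply, ContinuousLinearMap.comp_apply]
  rfl

end DetDeriv

section Calculus

variable {E : Type*} [NormedAddCommGroup E] [NormedSpace ℝ E] {n : ℕ}
  {f ξ : E → (Fin (n + 1) → ℝ)} {x : E}

theorem two_le_infty : (2 : WithTop ℕ∞) ≤ ∞ := by
  have h : ((2 : ℕ∞) : WithTop ℕ∞) ≤ ((⊤ : ℕ∞) : WithTop ℕ∞) := WithTop.coe_le_coe.2 le_top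
  exact h

theorem contDiffAt_fderiv {V : Type*} [NormedAddCommGroup V] [NormedSpace ℝ V] {f : E → V} {x : E}
    (hf : ContDiffAt ℝ ∞ f x) : ContDiffAt ℝ ∞ (fderiv ℝ f) x :=
  hf.fderiv_right (by simp)

theorem contDiffAt_frameMap
    (hf : ContDiffAt ℝ ∞ f x) (hξ : ContDiffAt ℝ ∞ ξ x) : ContDiffAt ℝ ∞ (frameMap f ξ) x := by
  have h1 : ContDiffAt ℝ ∞ (fun y => (fderiv ℝ f y).comp (ContinuousLinearMap.fst ℝ E ℝ)) x :=
    (contDiffAt_fderiv hf).clm_comp contDiffAt_const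
  have h2 : ContDiffAt ℝ ∞ (fun y => (ContinuousLinearMap.snd ℝ E ℝ).smulRight (ξ y)) x :=
    contDiffAt_const.smulRight hξ
  refine (h1.add h2).congr_of_eventuallyEq (Eventually.of_forall fun y => ?_)
  ext v <;> simp [frameMap]

theorem isSymm_fderiv_fderiv {V : Type*} [NormedAddCommGroup V] [NormedSpace ℝ V] {f : E → V}
    {x : E} (hf : ContDiffAt ℝ ∞ f x) (u v : E) :
    fderiv ℝ (fderiv ℝ f) x u v = fderiv ℝ (fderiv ℝ f) x v u :=
  hf.isSymmSndFDerivAt (by simp [two_le_infty]) u v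

/-- Derivative of a family of linear maps applied to a moving vector. -/
theorem fderiv_clm_apply_apply {V W : Type*} [NormedAddCommGroup V] [NormedSpace ℝ V]
    [NormedAddCommGroup W] [NormedSpace ℝ W] {T : E → V →L[ℝ] W} {w : E → V} {x : E}
    (hT : DifferentiableAt ℝ T x) (hw : DifferentiableAt ℝ w x) (u : E) :
    fderiv ℝ (fun y => T y (w y)) x u = fderiv ℝ T x u (w x) + T x (fderiv ℝ w x u) := by
  rw [fderiv_clm_apply hT hw]
  simp [add_comm]

theorem fderiv_clm_apply_const {V W : Type*} [NormedAddCommGroup V] [NormedSpace ℝ V]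
    [NormedAddCommGroup W] [NormedSpace ℝ W] {T : E → V →L[ℝ] W} {x : E}
    (hT : DifferentiableAt ℝ T x) (v : V) (u : E) :
    fderiv ℝ (fun y => T y v) x u = fderiv ℝ T x u v := by
  rw [fderiv_clm_apply_apply hT (differentiableAt_const v)]
  simp

theorem fderiv_clm_apply_const₂ {V W Z : Type*} [NormedAddCommGroup V] [NormedSpace ℝ V]
    [NormedAddCommGroup W] [NormedSpace ℝ W] [NormedAddCommGroup Z] [NormedSpace ℝ Z]
    {T : E → V →L[ℝ] W →L[ℝ] Z} {x : E}
    (hT : DifferentiableAt ℝ T x) (v : V) (w : W) (u : E) :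
    fderiv ℝ (fun y => T y v w) x u = fderiv ℝ T x u v w := by
  rw [fderiv_clm_apply_const (hT.clm_apply (differentiableAt_const v)), fderiv_clm_apply_const hT]

theorem isSymm_fderiv_fderiv_fderiv {V : Type*} [NormedAddCommGroup V] [NormedSpace ℝ V]
    {f : E → V} {x : E} (hf : ContDiffAt ℝ ∞ f x) (a u v : E) :
    fderiv ℝ (fderiv ℝ (fderiv ℝ f)) x a u v = fderiv ℝ (fderiv ℝ (fderiv ℝ f)) x a v u := by
  have hd2 := (contDiffAt_fderiv (contDiffAt_fderiv hf)).differentiableAt (by simp)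
  rw [← fderiv_clm_apply_const₂ hd2, ← fderiv_clm_apply_const₂ hd2]
  have hev : (fun y => fderiv ℝ (fderiv ℝ f) y u v) =ᶠ[𝓝 x]
      fun y => fderiv ℝ (fderiv ℝ f) y v u := by
    filter_upwards [(hf.of_le two_le_infty).eventually (by simp)] with y hy
    exact hy.isSymmSndFDerivAt (by simp) u v
  rw [hev.fderiv_eq]

theorem affineMetric_symm (hf : ContDiffAt ℝ ∞ f x) (u v : E) :
    affineMetric f ξ x u v = affineMetric f ξ x v u := by
  rw [affineMetric_apply, affineMetric_apply, isSymm_fderiv_fderiv hf]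

theorem inducedConnection_symm (hf : ContDiffAt ℝ ∞ f x) (u v : E) :
    inducedConnection f ξ x u v = inducedConnection f ξ x v u := by
  rw [inducedConnection_apply, inducedConnection_apply, isSymm_fderiv_fderiv hf]

theorem differenceTensor_add_right (u v w : E) :
    differenceTensor f ξ x u (v + w) =
      differenceTensor f ξ x u v + differenceTensor f ξ x u w := by
  have : leviCivita (affineMetric f ξ) x u (v + w) =
      leviCivita (affineMetric f ξ) x u v + leviCivita (affineMetric f ξ) x u w := by
    rw [leviCivita, leviCivita, leviCivita, ← map_add]
    congr 1
    ext z
    simp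
    ring
  rw [differenceTensor, this, differenceTensor, differenceTensor, map_add]
  abel

theorem differenceTensor_smul_right (u : E) (r : ℝ) (v : E) :
    differenceTensor f ξ x u (r • v) = r • differenceTensor f ξ x u v := by
  have : leviCivita (affineMetric f ξ) x u (r • v) =
      r • leviCivita (affineMetric f ξ) x u v := by
    rw [leviCivita, leviCivita, ← map_smul]
    congr 1
    ext z
    simp
    ring
  rw [differenceTensor, this, differenceTensor, map_smul, smul_sub]

theorem affineMetric_eq_repr {b : Module.Basis (Fin n) ℝ E}
    (hb : ∀ i j, affineMetric f ξ x (b i) (b j) = if i = j then 1 else 0) (u : E) (i : Fin n) :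
    affineMetric f ξ x u (b i) = b.repr u i := by
  conv_lhs => rw [← b.sum_repr u, map_sum, sum_apply]
  simp [hb]

end Calculus

section Structure

variable {E : Type*} [NormedAddCommGroup E] [NormedSpace ℝ E] [FiniteDimensional ℝ E] {n : ℕ}
  {f ξ : E → (Fin (n + 1) → ℝ)} {x : E}

theorem contDiffAt_frameMap_inverse (hf : ContDiffAt ℝ ∞ f x) (hξ : ContDiffAt ℝ ∞ ξ x)
    (h : (frameMap f ξ x).IsInvertible) :
    ContDiffAt ℝ ∞ (fun y => (frameMap f ξ y).inverse) x := by
  have := FiniteDimensional.complete ℝ E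
  exact h.contDiffAt_map_inverse.comp x (contDiffAt_frameMap hf hξ)

theorem contDiffAt_transversalPart (hf : ContDiffAt ℝ ∞ f x) (hξ : ContDiffAt ℝ ∞ ξ x)
    (h : (frameMap f ξ x).IsInvertible) : ContDiffAt ℝ ∞ (transversalPart f ξ) x :=
  contDiffAt_const.clm_comp (contDiffAt_frameMap_inverse hf hξ h)

theorem contDiffAt_affineMetric (hf : ContDiffAt ℝ ∞ f x) (hξ : ContDiffAt ℝ ∞ ξ x)
    (h : (frameMap f ξ x).IsInvertible) : ContDiffAt ℝ ∞ (affineMetric f ξ) x := by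
  refine ContDiffAt.clm_comp ?_ (contDiffAt_fderiv (contDiffAt_fderiv hf))
  exact (ContinuousLinearMap.contDiff _).contDiffAt.comp x (contDiffAt_transversalPart hf hξ h)

theorem fderiv_transversalPart_fderiv (hf : ContDiffAt ℝ ∞ f x) (hξ : ContDiffAt ℝ ∞ ξ x)
    (h : ∀ᶠ y in 𝓝 x, IsBlaschkeAt f ξ y) (u v : E) :
    fderiv ℝ (transversalPart f ξ) x u (fderiv ℝ f x v) = -affineMetric f ξ x u v := by
  have hT := (contDiffAt_transversalPart hf hξ h.self_of_nhds.transversal).differentiableAt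
    (by simp)
  have hw : DifferentiableAt ℝ (fun y => fderiv ℝ f y v) x :=
    ((contDiffAt_fderiv hf).differentiableAt (by simp)).clm_apply (differentiableAt_const v)
  have h0 : (fun y => transversalPart f ξ y (fderiv ℝ f y v)) =ᶠ[𝓝 x] fun _ => 0 :=
    h.mono fun y hy => transversalPart_fderiv hy.transversal v
  have h1 := fderiv_clm_apply_apply hT hw u
  rw [h0.fderiv_eq, fderiv_clm_apply_apply ((contDiffAt_fderiv hf).differentiableAt (by simp))
    (differentiableAt_const v)] at h1
  rw [affineMetric_apply]
  simp at h1
  linarith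

theorem fderiv_transversalPart_normal (hf : ContDiffAt ℝ ∞ f x) (hξ : ContDiffAt ℝ ∞ ξ x)
    (h : ∀ᶠ y in 𝓝 x, IsBlaschkeAt f ξ y) (u : E) :
    fderiv ℝ (transversalPart f ξ) x u (ξ x) = 0 := by
  have hT := (contDiffAt_transversalPart hf hξ h.self_of_nhds.transversal).differentiableAt
    (by simp)
  have h0 : (fun y => transversalPart f ξ y (ξ y)) =ᶠ[𝓝 x] fun _ => 1 :=
    h.mono fun y hy => transversalPart_normal hy.transversal
  have h1 := fderiv_clm_apply_apply hT (hξ.differentiableAt (by simp)) u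
  rw [h0.fderiv_eq, h.self_of_nhds.equiaffine] at h1
  simpa using h1.symm

theorem fderiv_affineMetric (hf : ContDiffAt ℝ ∞ f x) (hξ : ContDiffAt ℝ ∞ ξ x)
    (h : ∀ᶠ y in 𝓝 x, IsBlaschkeAt f ξ y) (w u v : E) :
    fderiv ℝ (affineMetric f ξ) x w u v =
      transversalPart f ξ x (fderiv ℝ (fderiv ℝ (fderiv ℝ f)) x w u v) -
        affineMetric f ξ x w (inducedConnection f ξ x u v) := by
  have hinv := h.self_of_nhds.transversal
  have hT := (contDiffAt_transversalPart hf hξ hinv).differentiableAt (by simp)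
  have hh := (contDiffAt_affineMetric hf hξ hinv).differentiableAt (by simp)
  have hd2 := (contDiffAt_fderiv (contDiffAt_fderiv hf)).differentiableAt (by simp)
  have hd2uv : DifferentiableAt ℝ (fun y => fderiv ℝ (fderiv ℝ f) y u v) x :=
    (hd2.clm_apply (differentiableAt_const u)).clm_apply (differentiableAt_const v)
  rw [← fderiv_clm_apply_const₂ hh]
  simp only [affineMetric_apply (x := _) u v]
  rw [fderiv_clm_apply_apply hT hd2uv, fderiv_clm_apply_const₂ hd2]
  have e3 := frame_decomposition hinv (fderiv ℝ (fderiv ℝ f) x u v)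
  conv_lhs => rw [← e3]
  rw [map_add, map_smul, fderiv_transversalPart_fderiv hf hξ h,
    fderiv_transversalPart_normal hf hξ h, ← inducedConnection_apply]
  simp
  ring

theorem affineMetric_isInvertible (h : IsBlaschkeAt f ξ x) :
    (affineMetric f ξ x).IsInvertible := by
  have hker : LinearMap.ker (affineMetric f ξ x : E →ₗ[ℝ] E →L[ℝ] ℝ) = ⊥ := by
    rw [LinearMap.ker_eq_bot']
    intro u hu
    refine h.nondegenerate u fun v => ?_
    have : affineMetric f ξ x u = 0 := hu
    simp [this]
  have hdim : Module.finrank ℝ E = Module.finrank ℝ (E →L[ℝ] ℝ) := by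
    rw [← (LinearMap.toContinuousLinearMap (𝕜 := ℝ) (E := E) (F' := ℝ)).finrank_eq,
      Module.finrank_linearMap]
    simp
  let e := LinearEquiv.ofInjectiveOfFinrankEq (affineMetric f ξ x : E →ₗ[ℝ] E →L[ℝ] ℝ)
    (LinearMap.ker_eq_bot.1 hker) hdim
  exact ⟨e.toContinuousLinearEquiv, by ext; rfl⟩

theorem affineMetric_leviCivita (h : IsBlaschkeAt f ξ x) (u v w : E) :
    affineMetric f ξ x (leviCivita (affineMetric f ξ) x u v) w =
      (1 / 2) * (fderiv ℝ (affineMetric f ξ) x u v w + fderiv ℝ (affineMetric f ξ) x v u w -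
        fderiv ℝ (affineMetric f ξ) x w u v) := by
  rw [leviCivita, (affineMetric_isInvertible h).self_apply_inverse]
  simp

/-- The cubic form `2 h(K(u, v), w)`, written so that its symmetry is apparent. -/
theorem affineMetric_differenceTensor (hf : ContDiffAt ℝ ∞ f x) (hξ : ContDiffAt ℝ ∞ ξ x)
    (h : ∀ᶠ y in 𝓝 x, IsBlaschkeAt f ξ y) (u v w : E) :
    2 * affineMetric f ξ x (differenceTensor f ξ x u v) w =
      affineMetric f ξ x (inducedConnection f ξ x u v) w +
      affineMetric f ξ x (inducedConnection f ξ x v w) u +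
      affineMetric f ξ x (inducedConnection f ξ x u w) v -
      transversalPart f ξ x (fderiv ℝ (fderiv ℝ (fderiv ℝ f)) x u v w) := by
  have s1 := isSymm_fderiv_fderiv (contDiffAt_fderiv hf)
  have s2 := isSymm_fderiv_fderiv_fderiv hf
  rw [differenceTensor, map_sub, sub_apply,
    affineMetric_leviCivita h.self_of_nhds, fderiv_affineMetric hf hξ h,
    fderiv_affineMetric hf hξ h, fderiv_affineMetric hf hξ h, s1 v u, s1 w u, s2 u w v,
    affineMetric_symm hf u, affineMetric_symm hf v, affineMetric_symm hf w]
  ring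

theorem cubicForm_symm_left (hf : ContDiffAt ℝ ∞ f x) (hξ : ContDiffAt ℝ ∞ ξ x)
    (h : ∀ᶠ y in 𝓝 x, IsBlaschkeAt f ξ y) (u v w : E) :
    affineMetric f ξ x (differenceTensor f ξ x u v) w =
      affineMetric f ξ x (differenceTensor f ξ x v u) w := by
  have h1 := affineMetric_differenceTensor hf hξ h u v w
  have h2 := affineMetric_differenceTensor hf hξ h v u w
  rw [inducedConnection_symm hf v u, isSymm_fderiv_fderiv (contDiffAt_fderiv hf) v u] at h2
  linarith

theorem cubicForm_symm_right (hf : ContDiffAt ℝ ∞ f x) (hξ : ContDiffAt ℝ ∞ ξ x)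
    (h : ∀ᶠ y in 𝓝 x, IsBlaschkeAt f ξ y) (u v w : E) :
    affineMetric f ξ x (differenceTensor f ξ x u v) w =
      affineMetric f ξ x (differenceTensor f ξ x u w) v := by
  have h1 := affineMetric_differenceTensor hf hξ h u v w
  have h2 := affineMetric_differenceTensor hf hξ h u w v
  rw [inducedConnection_symm hf w v, isSymm_fderiv_fderiv_fderiv hf u w v] at h2
  linarith

theorem differenceTensor_symm (hf : ContDiffAt ℝ ∞ f x) (hξ : ContDiffAt ℝ ∞ ξ x)
    (h : ∀ᶠ y in 𝓝 x, IsBlaschkeAt f ξ y) (u v : E) :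
    differenceTensor f ξ x u v = differenceTensor f ξ x v u := by
  refine sub_eq_zero.1 (h.self_of_nhds.nondegenerate _ fun w => ?_)
  rw [map_sub, sub_apply, cubicForm_symm_left hf hξ h, sub_self]

/-- The apolarity condition `tr K_u = 0`. -/
theorem apolarity (hf : ContDiffAt ℝ ∞ f x) (hξ : ContDiffAt ℝ ∞ ξ x)
    (h : ∀ᶠ y in 𝓝 x, IsBlaschkeAt f ξ y) {b : Module.Basis (Fin n) ℝ E}
    (hb : ∀ i j, affineMetric f ξ x (b i) (b j) = if i = j then 1 else 0) (u : E) :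
    ∑ i, affineMetric f ξ x (differenceTensor f ξ x u (b i)) (b i) = 0 := by
  have hinv := h.self_of_nhds.transversal
  have hd1 := (contDiffAt_fderiv hf).differentiableAt (by simp)
  have hh := (contDiffAt_affineMetric hf hξ hinv).differentiableAt (by simp)
  obtain ⟨L, hL, hLu⟩ := fderiv_det_eq_sum (x := x)
    (A := fun y => (Fin.snoc (fun i => fderiv ℝ f y (b i)) (ξ y) : Fin (n + 1) → Fin (n + 1) → ℝ))
    (A' := Fin.snoc (fun i => (fderiv ℝ (fderiv ℝ f) x).flip (b i)) (fderiv ℝ ξ x)) (by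
      intro k
      refine Fin.lastCases ?_ (fun i => ?_) k
      · simpa using (hξ.differentiableAt (by simp)).hasFDerivAt
      · simp only [Fin.snoc_castSucc]
        have := (hd1.clm_apply (differentiableAt_const (b i))).hasFDerivAt
        have e : fderiv ℝ (fun y => fderiv ℝ f y (b i)) x =
            (fderiv ℝ (fderiv ℝ f) x).flip (b i) := by
          ext v : 1
          rw [fderiv_clm_apply_const hd1, ContinuousLinearMap.flip_apply]
        rwa [e] at this)
  obtain ⟨T, hT, hTu⟩ := fderiv_det_eq_sum (x := x)
    (A := fun y i j => affineMetric f ξ y (b i) (b j))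
    (A' := fun i => ContinuousLinearMap.pi fun j =>
      fderiv ℝ (fun y => affineMetric f ξ y (b i) (b j)) x) (by
      intro i
      rw [hasFDerivAt_pi]
      intro j
      exact ((hh.clm_apply (differentiableAt_const (b i))).clm_apply
        (differentiableAt_const (b j))).hasFDerivAt)
  have hone : (Matrix.of fun i j => affineMetric f ξ x (b i) (b j)) = 1 := by
    ext i j
    simp [hb, Matrix.one_apply]
  have hTval : T u = ∑ i, fderiv ℝ (affineMetric f ξ) x u (b i) (b i) := by
    rw [hTu]
    refine Finset.sum_congr rfl fun i _ => ?_
    rw [hone, ← Matrix.cramer_transpose_apply, Matrix.transpose_one, Matrix.cramer_one]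
    simp [fderiv_clm_apply_const₂ hh]
  have hLval : L u = (∑ i, affineMetric f ξ x (inducedConnection f ξ x u (b i)) (b i)) *
      (frameMatrix f ξ b x).det := by
    have e := fun k w => det_updateRow_frameMatrix hinv b k w
    simp only [frameMatrix] at e
    rw [hLu, Fin.sum_univ_castSucc]
    simp only [Fin.snoc_castSucc, Fin.snoc_last, e, h.self_of_nhds.equiaffine, zero_mul, add_zero,
      affineMetric_eq_repr hb, Finset.sum_mul, inducedConnection_apply]
    rfl
  have hpos : ∀ᶠ y in 𝓝 x, 0 < (Matrix.of fun i j => affineMetric f ξ y (b i) (b j)).det := by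
    refine hT.continuousAt.eventually (lt_mem_nhds ?_)
    simp [hone]
  have hsq : (fun y => (frameMatrix f ξ b y).det ^ 2) =ᶠ[𝓝 x]
      fun y => (Matrix.of fun i j => affineMetric f ξ y (b i) (b j)).det := by
    filter_upwards [h, hpos] with y hy hy'
    rw [← sq_abs, frameMatrix, hy.volume b, Real.sq_sqrt (abs_nonneg _), abs_of_pos hy']
  have hval := hsq.self_of_nhds
  simp only [hone, Matrix.det_one] at hval
  have hder := (hL.pow 2).unique (hT.congr_of_eventuallyEq hsq)
  have hder' := congrArg (fun A : E →L[ℝ] ℝ => A u) hder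
  simp only [smul_apply, hLval, hTval, nsmul_eq_mul] at hder'
  have hmain : 2 * ∑ i, affineMetric f ξ x (inducedConnection f ξ x u (b i)) (b i) =
      ∑ i, fderiv ℝ (affineMetric f ξ) x u (b i) (b i) := by
    rw [← hder', frameMatrix] 
    rw [frameMatrix] at hval
    simp
    linear_combination (-2 * ∑ i, affineMetric f ξ x (inducedConnection f ξ x u (b i)) (b i)) * hval
  simp only [differenceTensor, map_sub, sub_apply, affineMetric_leviCivita h.self_of_nhds,
    Finset.sum_sub_distrib, add_sub_cancel_right, ← Finset.mul_sum]
  have hsym : ∀ i, fderiv ℝ (affineMetric f ξ) x u (b i) (b i) +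
      fderiv ℝ (affineMetric f ξ) x (b i) u (b i) - fderiv ℝ (affineMetric f ξ) x (b i) u (b i) =
      fderiv ℝ (affineMetric f ξ) x u (b i) (b i) := fun i => by ring
  linarith

end Structure

section NonsingularFrame

variable {E : Type*} [NormedAddCommGroup E] [NormedSpace ℝ E] {n : ℕ}
  {f ξ : E → (Fin (n + 1) → ℝ)} {x : E}

theorem det_frameMatrix_ne_zero (h : (frameMap f ξ x).IsInvertible)
    (b : Module.Basis (Fin n) ℝ E) : (frameMatrix f ξ b x).det ≠ 0 := by
  intro h0
  obtain ⟨v, hv, hv0⟩ := Matrix.exists_vecMul_eq_zero_iff.2 h0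
  have hsum : frameMap f ξ x (∑ i : Fin n, v i.castSucc • b i, v (Fin.last n)) = 0 := by
    rw [frameMap_apply, map_sum, ← hv0]
    ext j
    simp [Matrix.vecMul, dotProduct, Fin.sum_univ_castSucc, frameMatrix]
  have h1 : (∑ i : Fin n, v i.castSucc • b i, v (Fin.last n)) = (0 : E × ℝ) :=
    h.injective (by rw [hsum, map_zero])
  rw [Prod.mk_eq_zero] at h1
  have h2 := Fintype.linearIndependent_iff.1 b.linearIndependent _ h1.1
  refine hv (funext fun k => ?_)
  refine Fin.lastCases h1.2 (fun i => h2 i) k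

end NonsingularFrame

section ProductCalculus

variable {V : Type*} [NormedAddCommGroup V] [NormedSpace ℝ V]
  {W : Type*} [NormedAddCommGroup W] [NormedSpace ℝ W]

theorem differentiableAt_smul_prod {α : ℝ → ℝ} {χ : V → W} {x : ℝ × V}
    (hα : DifferentiableAt ℝ α x.1) (hχ : DifferentiableAt ℝ χ x.2) :
    DifferentiableAt ℝ (fun z : ℝ × V => α z.1 • χ z.2) x :=
  (hα.comp x differentiableAt_fst).smul (hχ.comp x differentiableAt_snd)

theorem fderiv_smul_prod {α : ℝ → ℝ} {χ : V → W} {x : ℝ × V}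
    (hα : DifferentiableAt ℝ α x.1) (hχ : DifferentiableAt ℝ χ x.2) (v : ℝ × V) :
    fderiv ℝ (fun z : ℝ × V => α z.1 • χ z.2) x v =
      (v.1 * deriv α x.1) • χ x.2 + α x.1 • fderiv ℝ χ x.2 v.2 := by
  have h1 : HasFDerivAt (fun z : ℝ × V => α z.1) _ x :=
    HasDerivAt.comp_hasFDerivAt (f := Prod.fst) x hα.hasDerivAt (hasFDerivAt_fst (𝕜 := ℝ) (p := x))
  have h2 : HasFDerivAt (fun z : ℝ × V => χ z.2) _ x :=
    hχ.hasFDerivAt.comp x hasFDerivAt_snd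
  rw [(h1.fun_smul h2).fderiv]
  simp [mul_comm, add_comm]

/-- A function that is locally independent of the second variable has no derivative along it. -/
theorem fderiv_eq_zero_of_indep_snd {g : ℝ × V → W} {x : ℝ × V} (hg : DifferentiableAt ℝ g x)
    (h : ∀ᶠ z in 𝓝 x, g z = g (z.1, x.2)) (u : V) : fderiv ℝ g x (0, u) = 0 := by
  have h1 : HasFDerivAt (fun z : ℝ × V => (z.1, x.2))
      ((ContinuousLinearMap.fst ℝ ℝ V).prod 0) x :=
    hasFDerivAt_fst.prodMk (hasFDerivAt_const _ _)
  have h2 : HasFDerivAt (fun z : ℝ × V => g (z.1, x.2)) _ x :=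
    HasFDerivAt.comp x (g := g) (f := fun z : ℝ × V => (z.1, x.2)) hg.hasFDerivAt h1
  rw [(h2.congr_of_eventuallyEq h).fderiv]
  exact map_zero (fderiv ℝ g x)

theorem fderiv_inl_eq_deriv {g : ℝ × V → W} {x : ℝ × V} (hg : DifferentiableAt ℝ g x) :
    HasDerivAt (fun t => g (t, x.2)) (fderiv ℝ g x (1, 0)) x.1 :=
  HasFDerivAt.comp_hasDerivAt x.1 (l := g) (f := fun t : ℝ => (t, x.2)) hg.hasFDerivAt
    ((hasDerivAt_id x.1).prodMk (hasDerivAt_const _ _))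

theorem fderiv_inr_eq_fderiv {g : ℝ × V → W} {x : ℝ × V} (hg : DifferentiableAt ℝ g x) (u : V) :
    fderiv ℝ (fun y => g (x.1, y)) x.2 u = fderiv ℝ g x (0, u) := by
  have h1 : HasFDerivAt (fun y : V => g (x.1, y)) _ x.2 :=
    HasFDerivAt.comp x.2 (g := g) (f := fun y : V => (x.1, y)) hg.hasFDerivAt
      ((hasFDerivAt_const _ _).prodMk (hasFDerivAt_id _))
  rw [h1.fderiv]
  simp

end ProductCalculus

/-- The first coordinate vector of `ℝ⁴ = ℝ × ℝ³`. -/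
def axisVec : Fin 4 → ℝ := Matrix.vecCons 1 0

/-- The inclusion of `ℝ³` into `ℝ⁴ = ℝ × ℝ³`. -/
noncomputable def incl : (Fin 3 → ℝ) →L[ℝ] (Fin 4 → ℝ) :=
  LinearMap.toContinuousLinearMap
    { toFun := fun w => Matrix.vecCons 0 w
      map_add' := fun v w => by simp
      map_smul' := fun r w => by simp }

theorem incl_apply (w : Fin 3 → ℝ) : incl w = Matrix.vecCons 0 w := rfl

theorem vecCons_eq (a : ℝ) (w : Fin 3 → ℝ) :
    (Matrix.vecCons a w : Fin 4 → ℝ) = a • axisVec + incl w := by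
  ext i
  refine Fin.cases ?_ (fun j => ?_) i <;> simp [axisVec, incl_apply]

/-- The map `(t, y) ↦ (γ₁ t, γ₂ t • ψ y)` is, on `J × U`, a positive definite affine hypersurface
with affine normal `ξ`, where `ψ` is an affine sphere with affine normal `-c ψ`, `|c| = 1`. -/
structure IsSuspension {V : Type*} [NormedAddCommGroup V] [NormedSpace ℝ V]
    (ψ : V → (Fin 3 → ℝ)) (c : ℝ) (γ₁ γ₂ : ℝ → ℝ) (f ξ : ℝ × V → (Fin 4 → ℝ))
    (J : Set ℝ) (U : Set V) : Prop where
  isOpen_left : IsOpen J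
  isOpen_right : IsOpen U
  abs_eq_one : |c| = 1
  smooth_sphere : ∀ y ∈ U, ContDiffAt ℝ ∞ ψ y
  blaschke_sphere : ∀ y ∈ U, IsBlaschkeAt ψ (fun z => -c • ψ z) y
  smooth_fst : ∀ t ∈ J, ContDiffAt ℝ ∞ γ₁ t
  smooth_snd : ∀ t ∈ J, ContDiffAt ℝ ∞ γ₂ t
  eq : ∀ t ∈ J, ∀ y ∈ U, f (t, y) = Matrix.vecCons (γ₁ t) (γ₂ t • ψ y)
  smooth : ∀ x ∈ J ×ˢ U, ContDiffAt ℝ ∞ f x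
  smooth_normal : ∀ x ∈ J ×ˢ U, ContDiffAt ℝ ∞ ξ x
  blaschke : ∀ x ∈ J ×ˢ U, IsBlaschkeAt f ξ x
  pos : ∀ x ∈ J ×ˢ U, ∀ u : ℝ × V, u ≠ 0 → 0 < affineMetric f ξ x u u

namespace IsSuspension

variable {V : Type*} [NormedAddCommGroup V] [NormedSpace ℝ V]
  {ψ : V → (Fin 3 → ℝ)} {c : ℝ} {γ₁ γ₂ : ℝ → ℝ} {f ξ : ℝ × V → (Fin 4 → ℝ)}
  {J : Set ℝ} {U : Set V} {x : ℝ × V}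

theorem eventually_mem (H : IsSuspension ψ c γ₁ γ₂ f ξ J U) (hx : x ∈ J ×ˢ U) :
    ∀ᶠ z in 𝓝 x, z ∈ J ×ˢ U :=
  (H.isOpen_left.prod H.isOpen_right).mem_nhds hx

theorem eventually_blaschke (H : IsSuspension ψ c γ₁ γ₂ f ξ J U) (hx : x ∈ J ×ˢ U) :
    ∀ᶠ z in 𝓝 x, IsBlaschkeAt f ξ z :=
  (H.eventually_mem hx).mono fun z hz => H.blaschke z hz

theorem differentiableAt_deriv {γ : ℝ → ℝ} {t : ℝ} (h : ContDiffAt ℝ ∞ γ t) :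
    DifferentiableAt ℝ (deriv γ) t := by
  have h1 := (contDiffAt_fderiv h).differentiableAt (by simp)
  exact h1.clm_apply (differentiableAt_const (1 : ℝ))

theorem fderiv_eq (H : IsSuspension ψ c γ₁ γ₂ f ξ J U) (hx : x ∈ J ×ˢ U) (v : ℝ × V) :
    fderiv ℝ f x v = (v.1 * deriv γ₁ x.1) • axisVec + (v.1 * deriv γ₂ x.1) • incl (ψ x.2) +
      γ₂ x.1 • incl (fderiv ℝ ψ x.2 v.2) := by
  have h1 := (H.smooth_fst _ hx.1).differentiableAt (by simp)
  have h2 := (H.smooth_snd _ hx.1).differentiableAt (by simp)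
  have h3 := (H.smooth_sphere _ hx.2).differentiableAt (by simp)
  have h4 : DifferentiableAt ℝ (fun y => incl (ψ y)) x.2 :=
    incl.differentiableAt.comp x.2 h3
  have hev : f =ᶠ[𝓝 x] fun z => γ₁ z.1 • axisVec + γ₂ z.1 • incl (ψ z.2) := by
    filter_upwards [H.eventually_mem hx] with z hz
    rw [← Prod.mk.eta (p := z), H.eq _ hz.1 _ hz.2, vecCons_eq, map_smul]
  rw [hev.fderiv_eq, fderiv_fun_add
    (differentiableAt_smul_prod (χ := fun _ => axisVec) h1 (differentiableAt_const _))
    (differentiableAt_smul_prod (χ := fun y => incl (ψ y)) h2 h4), add_apply,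
    fderiv_smul_prod (χ := fun _ => axisVec) h1 (differentiableAt_const _),
    fderiv_smul_prod (χ := fun y => incl (ψ y)) h2 h4, fderiv_fun_comp x.2 incl.differentiableAt h3]
  simp [add_assoc]

theorem fderiv_fderiv_eq (H : IsSuspension ψ c γ₁ γ₂ f ξ J U) (hx : x ∈ J ×ˢ U) (v w : ℝ × V) :
    fderiv ℝ (fderiv ℝ f) x v w =
      (v.1 * w.1 * deriv (deriv γ₁) x.1) • axisVec +
      (v.1 * w.1 * deriv (deriv γ₂) x.1) • incl (ψ x.2) +
      (w.1 * deriv γ₂ x.1) • incl (fderiv ℝ ψ x.2 v.2) +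
      (v.1 * deriv γ₂ x.1) • incl (fderiv ℝ ψ x.2 w.2) +
      γ₂ x.1 • incl (fderiv ℝ (fderiv ℝ ψ) x.2 v.2 w.2) := by
  have h1 := differentiableAt_deriv (H.smooth_fst _ hx.1)
  have h2 := differentiableAt_deriv (H.smooth_snd _ hx.1)
  have h2' := (H.smooth_snd _ hx.1).differentiableAt (by simp)
  have h3 := (H.smooth_sphere _ hx.2).differentiableAt (by simp)
  have h4 : DifferentiableAt ℝ (fun y => incl (ψ y)) x.2 := incl.differentiableAt.comp x.2 h3
  have h5 := (contDiffAt_fderiv (H.smooth_sphere _ hx.2)).differentiableAt (by simp)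
  have h6 : DifferentiableAt ℝ (fun y => fderiv ℝ ψ y w.2) x.2 :=
    h5.clm_apply (differentiableAt_const _)
  have h7 : DifferentiableAt ℝ (fun y => incl (fderiv ℝ ψ y w.2)) x.2 :=
    incl.differentiableAt.comp x.2 h6
  rw [← fderiv_clm_apply_const ((contDiffAt_fderiv (H.smooth _ hx)).differentiableAt (by simp))]
  have hev : (fun z => fderiv ℝ f z w) =ᶠ[𝓝 x] fun z => (deriv γ₁ z.1 • (w.1 • axisVec) +
      deriv γ₂ z.1 • (w.1 • incl (ψ z.2))) + γ₂ z.1 • incl (fderiv ℝ ψ z.2 w.2) := by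
    filter_upwards [H.eventually_mem hx] with z hz
    rw [H.fderiv_eq hz]
    simp only [smul_smul, mul_comm]
  have d1 := differentiableAt_smul_prod (x := x) (χ := fun _ : V => w.1 • axisVec) h1
    (differentiableAt_const _)
  have d2 := differentiableAt_smul_prod (χ := fun y => w.1 • incl (ψ y)) h2 (h4.const_smul w.1)
  have d3 := differentiableAt_smul_prod (χ := fun y => incl (fderiv ℝ ψ y w.2)) h2' h7
  rw [hev.fderiv_eq, fderiv_fun_add (d1.fun_add d2) d3, fderiv_fun_add d1 d2, add_apply, add_apply,
    fderiv_smul_prod (χ := fun _ => w.1 • axisVec) h1 (differentiableAt_const _),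
    fderiv_smul_prod (χ := fun y => w.1 • incl (ψ y)) h2 (h4.const_smul w.1),
    fderiv_smul_prod (χ := fun y => incl (fderiv ℝ ψ y w.2)) h2' h7,
    fderiv_fun_comp x.2 incl.differentiableAt h6, fderiv_fun_const_smul h4,
    fderiv_fun_comp x.2 incl.differentiableAt h3]
  simp only [ContinuousLinearMap.fderiv, ContinuousLinearMap.comp_apply, smul_apply,
    fderiv_clm_apply_const h5, fderiv_fun_const, Pi.zero_apply, zero_apply, smul_zero, add_zero,
    smul_smul]
  module

/-- The `ξ`-component of the axis direction. -/
noncomputable def axisComp (f ξ : ℝ × V → (Fin 4 → ℝ)) (x : ℝ × V) : ℝ :=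
  transversalPart f ξ x axisVec

/-- The `ξ`-component of the position vector of the affine sphere. -/
noncomputable def radialComp (ψ : V → (Fin 3 → ℝ)) (f ξ : ℝ × V → (Fin 4 → ℝ)) (x : ℝ × V) : ℝ :=
  transversalPart f ξ x (incl (ψ x.2))

theorem components_relation (H : IsSuspension ψ c γ₁ γ₂ f ξ J U) (hx : x ∈ J ×ˢ U) :
    deriv γ₁ x.1 * axisComp f ξ x + deriv γ₂ x.1 * radialComp ψ f ξ x = 0 := by
  have h1 := transversalPart_fderiv (H.blaschke x hx).transversal ((1 : ℝ), (0 : V))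
  rw [H.fderiv_eq hx] at h1
  simpa [axisComp, radialComp] using h1

/-- The square of the volume of a tangent basis and the position vector of the sphere. -/
theorem sq_det_sphere (H : IsSuspension ψ c γ₁ γ₂ f ξ J U) {y : V} (hy : y ∈ U)
    (b : Module.Basis (Fin 2) ℝ V) :
    (Matrix.of ![fderiv ℝ ψ y (b 0), fderiv ℝ ψ y (b 1), ψ y]).det ^ 2 =
      |(Matrix.of fun i j => affineMetric ψ (fun z => -c • ψ z) y (b i) (b j)).det| ∧
    (Matrix.of ![fderiv ℝ ψ y (b 0), fderiv ℝ ψ y (b 1), ψ y]).det ≠ 0 := by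
  have hB := H.blaschke_sphere y hy
  have hc : c ^ 2 = 1 := by rw [← sq_abs, H.abs_eq_one, one_pow]
  have h1 : (frameMatrix ψ (fun z => -c • ψ z) b y).det =
      -c * (Matrix.of ![fderiv ℝ ψ y (b 0), fderiv ℝ ψ y (b 1), ψ y]).det := by
    rw [Matrix.det_fin_three, Matrix.det_fin_three]
    simp [frameMatrix, Fin.snoc]
    ring
  have h2 := hB.volume b
  have h3 := det_frameMatrix_ne_zero hB.transversal b
  change |(frameMatrix ψ (fun z => -c • ψ z) b y).det| = _ at h2
  refine ⟨?_, fun h0 => h3 (by rw [h1, h0, mul_zero])⟩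
  have h4 := congrArg (· ^ 2) h2
  simp only [sq_abs, Real.sq_sqrt (abs_nonneg _)] at h4
  rw [h1, mul_pow, neg_sq, hc, one_mul] at h4
  exact h4

theorem hasFDerivAt_incl_sphere (H : IsSuspension ψ c γ₁ γ₂ f ξ J U) (hx : x ∈ J ×ˢ U) :
    HasFDerivAt (fun z : ℝ × V => incl (ψ z.2))
      (incl.comp ((fderiv ℝ ψ x.2).comp (ContinuousLinearMap.snd ℝ ℝ V))) x :=
  incl.hasFDerivAt.comp x (((H.smooth_sphere _ hx.2).differentiableAt (by simp)).hasFDerivAt.comp x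
    hasFDerivAt_snd)

theorem eventually_indep_snd (H : IsSuspension ψ c γ₁ γ₂ f ξ J U) (hx : x ∈ J ×ˢ U) {W : Type*}
    {g : ℝ × V → W} (hg : ∀ t ∈ J, ∀ y ∈ U, ∀ y' ∈ U, g (t, y) = g (t, y')) :
    ∀ᶠ z in 𝓝 x, g z = g (z.1, x.2) :=
  (H.eventually_mem hx).mono fun z hz => hg z.1 hz.1 z.2 hz.2 x.2 hx.2

theorem differentiableAt_transversalPart [FiniteDimensional ℝ V]
    (H : IsSuspension ψ c γ₁ γ₂ f ξ J U) (hx : x ∈ J ×ˢ U) :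
    DifferentiableAt ℝ (transversalPart f ξ) x :=
  (contDiffAt_transversalPart (H.smooth x hx) (H.smooth_normal x hx)
    (H.blaschke x hx).transversal).differentiableAt (by simp)

theorem differentiableAt_axisComp [FiniteDimensional ℝ V]
    (H : IsSuspension ψ c γ₁ γ₂ f ξ J U)
    (hx : x ∈ J ×ˢ U) : DifferentiableAt ℝ (axisComp f ξ) x :=
  (H.differentiableAt_transversalPart hx).clm_apply (differentiableAt_const _)

theorem differentiableAt_radialComp [FiniteDimensional ℝ V]
    (H : IsSuspension ψ c γ₁ γ₂ f ξ J U)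
    (hx : x ∈ J ×ˢ U) : DifferentiableAt ℝ (radialComp ψ f ξ) x :=
  (H.differentiableAt_transversalPart hx).clm_apply (H.hasFDerivAt_incl_sphere hx).differentiableAt

theorem fderiv_transversalPart_axis [FiniteDimensional ℝ V]
    (H : IsSuspension ψ c γ₁ γ₂ f ξ J U) (hx : x ∈ J ×ˢ U)
    (v : ℝ × V) :
    fderiv ℝ (transversalPart f ξ) x v axisVec = fderiv ℝ (axisComp f ξ) x v :=
  (fderiv_clm_apply_const (H.differentiableAt_transversalPart hx) _ _).symm

variable [Nontrivial V]

theorem scale_ne_zero (H : IsSuspension ψ c γ₁ γ₂ f ξ J U) (hx : x ∈ J ×ˢ U) : γ₂ x.1 ≠ 0 := by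
  intro h0
  obtain ⟨u, hu⟩ := exists_ne (0 : V)
  have h1 := tangentialPart_fderiv (H.blaschke x hx).transversal ((0 : ℝ), u)
  rw [H.fderiv_eq hx, h0] at h1
  simp at h1
  exact hu (congrArg Prod.snd h1).symm

theorem incl_fderiv_eq (H : IsSuspension ψ c γ₁ γ₂ f ξ J U) (hx : x ∈ J ×ˢ U) (u : V) :
    incl (fderiv ℝ ψ x.2 u) = fderiv ℝ f x (0, (γ₂ x.1)⁻¹ • u) := by
  rw [H.fderiv_eq hx]
  simp [smul_smul, H.scale_ne_zero hx]

theorem transversalPart_incl_fderiv (H : IsSuspension ψ c γ₁ γ₂ f ξ J U) (hx : x ∈ J ×ˢ U)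
    (u : V) : transversalPart f ξ x (incl (fderiv ℝ ψ x.2 u)) = 0 := by
  rw [H.incl_fderiv_eq hx, transversalPart_fderiv (H.blaschke x hx).transversal]

theorem affineMetric_eq (H : IsSuspension ψ c γ₁ γ₂ f ξ J U) (hx : x ∈ J ×ˢ U) (v w : ℝ × V) :
    affineMetric f ξ x v w =
      v.1 * w.1 * (deriv (deriv γ₁) x.1 * axisComp f ξ x +
        deriv (deriv γ₂) x.1 * radialComp ψ f ξ x) -
      c * (γ₂ x.1 * radialComp ψ f ξ x) *
        affineMetric ψ (fun z => -c • ψ z) x.2 v.2 w.2 := by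
  have h1 := frame_decomposition (H.blaschke_sphere _ hx.2).transversal
    (fderiv ℝ (fderiv ℝ ψ) x.2 v.2 w.2)
  rw [affineMetric_apply, H.fderiv_fderiv_eq hx, ← h1]
  simp only [map_add, map_smul, H.transversalPart_incl_fderiv hx, smul_eq_mul, affineMetric_apply,
    axisComp, radialComp]
  ring

theorem radialComp_ne_zero (H : IsSuspension ψ c γ₁ γ₂ f ξ J U) (hx : x ∈ J ×ˢ U) :
    radialComp ψ f ξ x ≠ 0 := by
  intro h0
  obtain ⟨u, hu⟩ := exists_ne (0 : V)
  have h1 := H.pos x hx (0, u) (by simp [hu])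
  rw [H.affineMetric_eq hx, h0] at h1
  simp at h1

theorem deriv_fst_ne_zero (H : IsSuspension ψ c γ₁ γ₂ f ξ J U) (hx : x ∈ J ×ˢ U) :
    deriv γ₁ x.1 ≠ 0 := by
  intro h0
  have h1 := H.components_relation hx
  rw [h0, zero_mul, zero_add, mul_eq_zero] at h1
  have h2 := h1.resolve_right (H.radialComp_ne_zero hx)
  have h3 := tangentialPart_fderiv (H.blaschke x hx).transversal ((1 : ℝ), (0 : V))
  rw [H.fderiv_eq hx, h0, h2] at h3
  simp at h3
  exact zero_ne_one (congrArg Prod.fst h3)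

theorem metric_axis_eq (H : IsSuspension ψ c γ₁ γ₂ f ξ J U) (hx : x ∈ J ×ˢ U) :
    affineMetric f ξ x (1, 0) (1, 0) = deriv (deriv γ₁) x.1 * axisComp f ξ x +
        deriv (deriv γ₂) x.1 * radialComp ψ f ξ x := by
  rw [H.affineMetric_eq hx]
  simp

end IsSuspension

section ProductBasis

variable {V : Type*} [AddCommGroup V] [Module ℝ V]

/-- The basis `(a, 0), (0, b₀), (0, b₁)` of `ℝ × V`. -/
noncomputable def prodBasis (a : ℝˣ) (b : Module.Basis (Fin 2) ℝ V) :
    Module.Basis (Fin 3) ℝ (ℝ × V) :=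
  (((Module.Basis.singleton (Fin 1) ℝ).unitsSMul fun _ => a).prod b).reindex
    (finSumFinEquiv (m := 1) (n := 2))

theorem prodBasis_zero (a : ℝˣ) (b : Module.Basis (Fin 2) ℝ V) :
    prodBasis a b 0 = ((a : ℝ), 0) := by
  have : (finSumFinEquiv (m := 1) (n := 2)).symm 0 = Sum.inl 0 := by decide
  rw [prodBasis, Module.Basis.reindex_apply, this]
  simp [Module.Basis.unitsSMul_apply, Units.smul_def]

theorem prodBasis_one (a : ℝˣ) (b : Module.Basis (Fin 2) ℝ V) :
    prodBasis a b 1 = (0, b 0) := by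
  have : (finSumFinEquiv (m := 1) (n := 2)).symm 1 = Sum.inr 0 := by decide
  rw [prodBasis, Module.Basis.reindex_apply, this]
  simp

theorem prodBasis_two (a : ℝˣ) (b : Module.Basis (Fin 2) ℝ V) :
    prodBasis a b 2 = (0, b 1) := by
  have : (finSumFinEquiv (m := 1) (n := 2)).symm 2 = Sum.inr 1 := by decide
  rw [prodBasis, Module.Basis.reindex_apply, this]
  simp

end ProductBasis

namespace IsSuspension

variable {V : Type*} [NormedAddCommGroup V] [NormedSpace ℝ V]
  [Nontrivial V]
  {ψ : V → (Fin 3 → ℝ)} {c : ℝ} {γ₁ γ₂ : ℝ → ℝ} {f ξ : ℝ × V → (Fin 4 → ℝ)}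
  {J : Set ℝ} {U : Set V} {x : ℝ × V}

theorem volume_eq (H : IsSuspension ψ c γ₁ γ₂ f ξ J U) (hx : x ∈ J ×ˢ U)
    (b : Module.Basis (Fin 2) ℝ V) :
    deriv γ₁ x.1 ^ 2 * γ₂ x.1 ^ 2 =
      radialComp ψ f ξ x ^ 4 * affineMetric f ξ x (1, 0) (1, 0) := by
  have hinv := (H.blaschke x hx).transversal
  obtain ⟨hD, hD0⟩ := H.sq_det_sphere hx.2 b
  set D := (Matrix.of ![fderiv ℝ ψ x.2 (b 0), fderiv ℝ ψ x.2 (b 1), ψ x.2]).det with hDdef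
  have hc : c ^ 2 = 1 := by rw [← sq_abs, H.abs_eq_one, one_pow]
  have h1 : deriv γ₁ x.1 * γ₂ x.1 ^ 2 * D =
      radialComp ψ f ξ x * (frameMatrix f ξ (prodBasis 1 b) x).det := by
    rw [radialComp, ← det_snoc_eq hinv, Matrix.det_succ_column_zero, hDdef, Matrix.det_fin_three]
    simp [Fin.sum_univ_succ, Fin.snoc, Matrix.det_fin_three, Matrix.submatrix, H.fderiv_eq hx,
      prodBasis_zero, prodBasis_one, axisVec, incl_apply, Fin.succAbove]
    have e : ∀ h, Fin.castPred (2 : Fin 4) h = (2 : Fin 3) := fun _ => rfl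
    simp only [e, prodBasis_two]
    ring
  have h2 := (H.blaschke x hx).volume (prodBasis 1 b)
  change |(frameMatrix f ξ (prodBasis 1 b) x).det| = _ at h2
  have h3 := congrArg (· ^ 2) h2
  simp only [sq_abs, Real.sq_sqrt (abs_nonneg _)] at h3
  have htt := H.pos x hx (1, 0) (by simp)
  have h4 : (Matrix.of fun i j => affineMetric f ξ x (prodBasis 1 b i) (prodBasis 1 b j)).det =
      affineMetric f ξ x (1, 0) (1, 0) * (c * (γ₂ x.1 * radialComp ψ f ξ x)) ^ 2 *
        (Matrix.of fun i j => affineMetric ψ (fun z => -c • ψ z) x.2 (b i) (b j)).det := by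
    rw [Matrix.det_fin_three, Matrix.det_fin_two]
    simp [prodBasis_zero, prodBasis_one, prodBasis_two, H.affineMetric_eq hx]
    ring
  rw [h4, abs_mul, ← hD, abs_of_nonneg (by positivity)] at h3
  have h5 : (deriv γ₁ x.1 ^ 2 * γ₂ x.1 ^ 2) * (γ₂ x.1 ^ 2 * D ^ 2) =
      (radialComp ψ f ξ x ^ 4 * affineMetric f ξ x (1, 0) (1, 0)) * (γ₂ x.1 ^ 2 * D ^ 2) := by
    linear_combination (deriv γ₁ x.1 * γ₂ x.1 ^ 2 * D +
      radialComp ψ f ξ x * (frameMatrix f ξ (prodBasis 1 b) x).det) * h1 +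
      radialComp ψ f ξ x ^ 2 * h3 + affineMetric f ξ x (1, 0) (1, 0) * γ₂ x.1 ^ 2 *
        radialComp ψ f ξ x ^ 4 * D ^ 2 * hc
  exact mul_right_cancel₀
    (mul_ne_zero (pow_ne_zero _ (H.scale_ne_zero hx)) (pow_ne_zero _ hD0)) h5

theorem radialComp_pow_five (H : IsSuspension ψ c γ₁ γ₂ f ξ J U) (hx : x ∈ J ×ˢ U)
    (b : Module.Basis (Fin 2) ℝ V) :
    deriv γ₁ x.1 ^ 3 * γ₂ x.1 ^ 2 = radialComp ψ f ξ x ^ 5 *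
      (deriv γ₁ x.1 * deriv (deriv γ₂) x.1 - deriv (deriv γ₁) x.1 * deriv γ₂ x.1) := by
  linear_combination deriv γ₁ x.1 * H.volume_eq hx b +
    radialComp ψ f ξ x ^ 4 * deriv γ₁ x.1 * H.metric_axis_eq hx +
    radialComp ψ f ξ x ^ 4 * deriv (deriv γ₁) x.1 * H.components_relation hx

theorem radialComp_indep (H : IsSuspension ψ c γ₁ γ₂ f ξ J U) (b : Module.Basis (Fin 2) ℝ V)
    {t : ℝ} (ht : t ∈ J) {y y' : V} (hy : y ∈ U) (hy' : y' ∈ U) :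
    radialComp ψ f ξ (t, y) = radialComp ψ f ξ (t, y') := by
  have hx : (t, y) ∈ J ×ˢ U := ⟨ht, hy⟩
  have hx' : (t, y') ∈ J ×ˢ U := ⟨ht, hy'⟩
  have h1 := H.radialComp_pow_five hx b
  have h2 := H.radialComp_pow_five hx' b
  have h3 : deriv γ₁ t ^ 3 * γ₂ t ^ 2 ≠ 0 :=
    mul_ne_zero (pow_ne_zero _ (H.deriv_fst_ne_zero hx)) (pow_ne_zero _ (H.scale_ne_zero hx))
  simp only at h1 h2
  have h4 := right_ne_zero_of_mul (h1 ▸ h3)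
  have h5 : radialComp ψ f ξ (t, y) ^ 5 = radialComp ψ f ξ (t, y') ^ 5 :=
    mul_right_cancel₀ h4 (h1.symm.trans h2)
  exact (Odd.strictMono_pow (by decide : Odd 5)).injective h5

theorem axisComp_indep (H : IsSuspension ψ c γ₁ γ₂ f ξ J U) (b : Module.Basis (Fin 2) ℝ V)
    {t : ℝ} (ht : t ∈ J) {y y' : V} (hy : y ∈ U) (hy' : y' ∈ U) :
    axisComp f ξ (t, y) = axisComp f ξ (t, y') := by
  have hx : (t, y) ∈ J ×ˢ U := ⟨ht, hy⟩
  have hx' : (t, y') ∈ J ×ˢ U := ⟨ht, hy'⟩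
  have h1 := H.components_relation hx
  have h2 := H.components_relation hx'
  rw [← H.radialComp_indep b ht hy hy'] at h2
  simp only at h1 h2
  exact mul_left_cancel₀ (H.deriv_fst_ne_zero hx) (by simp only; linarith)

theorem metric_axis_indep (H : IsSuspension ψ c γ₁ γ₂ f ξ J U) (b : Module.Basis (Fin 2) ℝ V)
    {t : ℝ} (ht : t ∈ J) {y y' : V} (hy : y ∈ U) (hy' : y' ∈ U) :
    affineMetric f ξ (t, y) (1, 0) (1, 0) = affineMetric f ξ (t, y') (1, 0) (1, 0) := by
  rw [H.metric_axis_eq ⟨ht, hy⟩, H.metric_axis_eq ⟨ht, hy'⟩, H.radialComp_indep b ht hy hy',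
    H.axisComp_indep b ht hy hy']

variable [FiniteDimensional ℝ V]

theorem fderiv_transversalPart_radial (H : IsSuspension ψ c γ₁ γ₂ f ξ J U) (hx : x ∈ J ×ˢ U)
    (v : ℝ × V) :
    fderiv ℝ (transversalPart f ξ) x v (incl (ψ x.2)) = fderiv ℝ (radialComp ψ f ξ) x v := by
  have h1 := fderiv_clm_apply_apply (H.differentiableAt_transversalPart hx)
    (H.hasFDerivAt_incl_sphere hx).differentiableAt v
  rw [(H.hasFDerivAt_incl_sphere hx).fderiv] at h1
  simp only [ContinuousLinearMap.comp_apply, H.transversalPart_incl_fderiv hx, add_zero] at h1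
  exact h1.symm

/-- The affine normal lies in the plane spanned by the axis and the position vector. -/
theorem exists_normal_eq (H : IsSuspension ψ c γ₁ γ₂ f ξ J U) (b : Module.Basis (Fin 2) ℝ V)
    (hx : x ∈ J ×ˢ U) : ∃ p q : ℝ, ξ x = p • axisVec + q • incl (ψ x.2) := by
  have hS := (H.blaschke_sphere _ hx.2).transversal
  obtain ⟨w, hw⟩ : ∃ w : Fin 3 → ℝ, ξ x = ξ x 0 • axisVec + incl w :=
    ⟨Matrix.vecTail (ξ x), by rw [← vecCons_eq]; exact (Matrix.cons_head_tail (ξ x)).symm⟩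
  have hw' := frame_decomposition hS w
  set z := tangentialPart ψ (fun z => -c • ψ z) x.2 w
  have hz : z = 0 := by
    by_contra hz
    have h1 := fderiv_transversalPart_normal (H.smooth x hx) (H.smooth_normal x hx)
      (H.eventually_blaschke hx) (0, z)
    rw [hw, ← hw', map_add, map_add, map_add, map_smul, map_smul, map_smul, map_smul, map_smul,
      H.fderiv_transversalPart_axis hx, H.fderiv_transversalPart_radial hx,
      fderiv_eq_zero_of_indep_snd (H.differentiableAt_axisComp hx) (H.eventually_indep_snd hx
        fun t ht y hy y' hy' => H.axisComp_indep b ht hy hy'),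
      fderiv_eq_zero_of_indep_snd (H.differentiableAt_radialComp hx) (H.eventually_indep_snd hx
        fun t ht y hy y' hy' => H.radialComp_indep b ht hy hy'),
      H.incl_fderiv_eq hx, fderiv_transversalPart_fderiv (H.smooth x hx) (H.smooth_normal x hx)
      (H.eventually_blaschke hx)] at h1
    have h2 : ((0 : ℝ), (γ₂ x.1)⁻¹ • z) = (γ₂ x.1)⁻¹ • ((0 : ℝ), z) := by simp
    rw [h2, map_smul] at h1
    simp [H.scale_ne_zero hx] at h1
    exact (H.pos x hx (0, z) (by simp [hz])).ne' h1
  refine ⟨ξ x 0, transversalPart ψ (fun z => -c • ψ z) x.2 w * -c, ?_⟩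
  conv_lhs => rw [hw, ← hw', hz, map_zero, zero_add, smul_smul, map_smul]

/-- The coefficients of the affine normal depend on the curve parameter only. -/
theorem normal_coeff_indep (H : IsSuspension ψ c γ₁ γ₂ f ξ J U) (b : Module.Basis (Fin 2) ℝ V)
    {t : ℝ} (ht : t ∈ J) {y y' : V} (hy : y ∈ U) (hy' : y' ∈ U) {p q : ℝ}
    (h : ξ (t, y) = p • axisVec + q • incl (ψ y)) :
    ξ (t, y') = p • axisVec + q • incl (ψ y') := by
  have hx : (t, y) ∈ J ×ˢ U := ⟨ht, hy⟩
  have hx' : (t, y') ∈ J ×ˢ U := ⟨ht, hy'⟩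
  have key : ∀ {y : V}, y ∈ U → ∀ {p q : ℝ}, ξ (t, y) = p • axisVec + q • incl (ψ y) →
      p * axisComp f ξ (t, y) + q * radialComp ψ f ξ (t, y) = 1 ∧
      p * fderiv ℝ (axisComp f ξ) (t, y) (1, 0) +
        q * fderiv ℝ (radialComp ψ f ξ) (t, y) (1, 0) = 0 := by
    intro y hy p q h
    have hx : (t, y) ∈ J ×ˢ U := ⟨ht, hy⟩
    constructor
    · have h1 := transversalPart_normal (H.blaschke _ hx).transversal
      rw [h, map_add, map_smul, map_smul] at h1
      exact h1
    · have h1 := fderiv_transversalPart_normal (H.smooth _ hx) (H.smooth_normal _ hx)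
        (H.eventually_blaschke hx) (1, 0)
      have h2 := H.fderiv_transversalPart_radial hx (1, 0)
      simp only at h2
      rw [h, map_add, map_smul, map_smul, H.fderiv_transversalPart_axis hx, h2] at h1
      exact h1
  have hder : ∀ {g : ℝ × V → ℝ}, (∀ x ∈ J ×ˢ U, DifferentiableAt ℝ g x) →
      (∀ t ∈ J, ∀ y ∈ U, ∀ y' ∈ U, g (t, y) = g (t, y')) →
      fderiv ℝ g (t, y') (1, 0) = fderiv ℝ g (t, y) (1, 0) := by
    intro g hg hind
    have h1 := fderiv_inl_eq_deriv (hg _ hx)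
    have h2 := fderiv_inl_eq_deriv (hg _ hx')
    refine h2.unique (h1.congr_of_eventuallyEq ?_)
    filter_upwards [H.isOpen_left.mem_nhds ht] with s hs
    exact hind s hs _ hy' _ hy
  obtain ⟨p', q', h'⟩ := H.exists_normal_eq b hx'
  obtain ⟨k1, k2⟩ := key hy h
  obtain ⟨l1, l2⟩ := key hy' h'
  rw [hder (fun x hx => H.differentiableAt_axisComp hx)
      (fun t ht y hy y' hy' => H.axisComp_indep b ht hy hy'),
    hder (fun x hx => H.differentiableAt_radialComp hx)
      (fun t ht y hy y' hy' => H.radialComp_indep b ht hy hy')] at l2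
  rw [H.axisComp_indep b ht hy' hy, H.radialComp_indep b ht hy' hy] at l1
  have h1 := fderiv_transversalPart_fderiv (H.smooth _ hx) (H.smooth_normal _ hx)
    (H.eventually_blaschke hx) (1, 0) (1, 0)
  have h2 := H.fderiv_transversalPart_radial hx (1, 0)
  rw [H.fderiv_eq hx] at h1
  simp only [map_zero, smul_zero, add_zero, one_mul, map_add, map_smul, smul_eq_mul,
    H.fderiv_transversalPart_axis hx] at h1 h2
  rw [h2] at h1
  have h3 := H.pos _ hx (1, 0) (by simp)
  have h4 := H.components_relation hx
  simp only at h4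
  set P := axisComp f ξ (t, y)
  set Q := radialComp ψ f ξ (t, y)
  set P' := fderiv ℝ (axisComp f ξ) (t, y) (1, 0)
  set Q' := fderiv ℝ (radialComp ψ f ξ) (t, y) (1, 0)
  have hQ : Q ≠ 0 := H.radialComp_ne_zero hx
  have hω : P * Q' - Q * P' ≠ 0 := by
    intro h0
    have : Q * affineMetric f ξ (t, y) (1, 0) (1, 0) = 0 := by
      linear_combination Q * h1 + deriv γ₁ t * h0 - Q' * h4
    exact h3.ne' ((mul_eq_zero.1 this).resolve_left hQ)
  have e1 : p' = p := by
    have : (p' - p) * (P * Q' - Q * P') = 0 := by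
      linear_combination Q' * (l1 - k1) - Q * (l2 - k2)
    exact sub_eq_zero.1 ((mul_eq_zero.1 this).resolve_right hω)
  have e2 : q' = q := by
    have : (q' - q) * (P * Q' - Q * P') = 0 := by
      linear_combination P * (l2 - k2) - P' * (l1 - k1)
    exact sub_eq_zero.1 ((mul_eq_zero.1 this).resolve_right hω)
  rw [h', e1, e2]

theorem exists_tangentialPart_eq (H : IsSuspension ψ c γ₁ γ₂ f ξ J U)
    (b : Module.Basis (Fin 2) ℝ V) (hx : x ∈ J ×ˢ U) (p q : ℝ) :
    ∃ s : ℝ, tangentialPart f ξ x (p • axisVec + q • incl (ψ x.2)) = s • ((1 : ℝ), (0 : V)) := by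
  have hinv := (H.blaschke x hx).transversal
  obtain ⟨α, β, hξ⟩ := H.exists_normal_eq b hx
  set w := p • axisVec + q • incl (ψ x.2) with hw
  have h1 : transversalPart f ξ x (w - transversalPart f ξ x w • ξ x) = 0 := by
    rw [map_sub, map_smul, transversalPart_normal hinv]
    simp
  have h2 : tangentialPart f ξ x (w - transversalPart f ξ x w • ξ x) =
      tangentialPart f ξ x w := by
    rw [map_sub, map_smul, tangentialPart_normal hinv]
    simp
  set r := transversalPart f ξ x w
  have h3 : w - r • ξ x = (p - r * α) • axisVec + (q - r * β) • incl (ψ x.2) := by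
    rw [hξ, hw]
    module
  rw [h3, map_add, map_smul, map_smul] at h1
  change (p - r * α) * axisComp f ξ x + (q - r * β) * radialComp ψ f ξ x = 0 at h1
  have hg := H.deriv_fst_ne_zero hx
  have hQ := H.radialComp_ne_zero hx
  have h4 := H.components_relation hx
  refine ⟨(p - r * α) / deriv γ₁ x.1, ?_⟩
  rw [← h2, h3]
  have h5 : q - r * β = (p - r * α) / deriv γ₁ x.1 * deriv γ₂ x.1 := by
    field_simp
    refine mul_right_cancel₀ hQ ?_
    linear_combination deriv γ₁ x.1 * h1 - (p - r * α) * h4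
  have h6 : (p - r * α) • axisVec + (q - r * β) • incl (ψ x.2) =
      fderiv ℝ f x (((p - r * α) / deriv γ₁ x.1) • ((1 : ℝ), (0 : V))) := by
    rw [H.fderiv_eq hx, h5]
    simp [hg]
  rw [h6, tangentialPart_fderiv hinv]

theorem shapeOperator_axis (H : IsSuspension ψ c γ₁ γ₂ f ξ J U)
    (b : Module.Basis (Fin 2) ℝ V) (hx : x ∈ J ×ˢ U) :
    ∃ s : ℝ, shapeOperator f ξ x (1, 0) = s • ((1 : ℝ), (0 : V)) := by
  have hd := fderiv_inl_eq_deriv ((H.smooth_normal x hx).differentiableAt (by simp))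
  set M : Submodule ℝ (Fin 4 → ℝ) := Submodule.span ℝ {axisVec, incl (ψ x.2)}
  have hmem : fderiv ℝ ξ x (1, 0) ∈ M := by
    have h1 := range_derivWithin_subset_closure_span_image (fun t => ξ (t, x.2)) (s := J) (t := J)
      (by rw [Set.inter_self]; exact subset_closure)
    have h2 := h1 ⟨x.1, rfl⟩
    rw [(hd.hasDerivWithinAt).derivWithin (H.isOpen_left.uniqueDiffWithinAt hx.1)] at h2
    have h3 : (Submodule.span ℝ ((fun t => ξ (t, x.2)) '' J) : Set (Fin 4 → ℝ)) ⊆ M := by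
      refine Submodule.span_le.2 ?_
      rintro _ ⟨t, ht, rfl⟩
      obtain ⟨p, q, hpq⟩ := H.exists_normal_eq b (x := (t, x.2)) ⟨ht, hx.2⟩
      exact Submodule.mem_span_pair.2 ⟨p, q, hpq.symm⟩
    exact closure_minimal h3 M.closed_of_finiteDimensional h2
  obtain ⟨p, q, hpq⟩ := Submodule.mem_span_pair.1 hmem
  obtain ⟨s, hs⟩ := H.exists_tangentialPart_eq b hx p q
  refine ⟨-s, ?_⟩
  rw [shapeOperator, neg_apply, ContinuousLinearMap.comp_apply, ← hpq, hs, neg_smul]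

theorem shapeOperator_sphere (H : IsSuspension ψ c γ₁ γ₂ f ξ J U)
    (b : Module.Basis (Fin 2) ℝ V) (hx : x ∈ J ×ˢ U) :
    ∃ s : ℝ, ∀ u : V, shapeOperator f ξ x (0, u) = s • ((0 : ℝ), u) := by
  obtain ⟨p, q, hpq⟩ := H.exists_normal_eq b hx
  refine ⟨-(q * (γ₂ x.1)⁻¹), fun u => ?_⟩
  have hev : (fun y => ξ (x.1, y)) =ᶠ[𝓝 x.2] fun y => p • axisVec + q • incl (ψ y) := by
    filter_upwards [H.isOpen_right.mem_nhds hx.2] with y hy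
    exact H.normal_coeff_indep b hx.1 hx.2 hy hpq
  have h3 := (H.smooth_sphere _ hx.2).differentiableAt (by simp)
  have h4 : DifferentiableAt ℝ (fun y => incl (ψ y)) x.2 := incl.differentiableAt.comp x.2 h3
  have h5 : fderiv ℝ ξ x (0, u) = q • incl (fderiv ℝ ψ x.2 u) := by
    rw [← fderiv_inr_eq_fderiv ((H.smooth_normal x hx).differentiableAt (by simp)),
      hev.fderiv_eq, fderiv_const_add, fderiv_fun_const_smul h4,
      fderiv_fun_comp x.2 incl.differentiableAt h3]
    simp
  rw [shapeOperator, neg_apply, ContinuousLinearMap.comp_apply, h5, map_smul,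
    H.incl_fderiv_eq hx, tangentialPart_fderiv (H.blaschke x hx).transversal]
  simp [smul_smul]

theorem cubicForm_axis_axis (H : IsSuspension ψ c γ₁ γ₂ f ξ J U)
    (b : Module.Basis (Fin 2) ℝ V) (hx : x ∈ J ×ˢ U) (u : V) :
    affineMetric f ξ x (differenceTensor f ξ x (1, 0) (1, 0)) (0, u) = 0 := by
  have hB := H.blaschke x hx
  have hh := (contDiffAt_affineMetric (H.smooth x hx) (H.smooth_normal x hx)
    hB.transversal).differentiableAt (by simp)
  have h1 : ∃ s : ℝ, inducedConnection f ξ x (1, 0) (1, 0) = s • ((1 : ℝ), (0 : V)) := by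
    obtain ⟨s, hs⟩ := H.exists_tangentialPart_eq b hx (deriv (deriv γ₁) x.1)
      (deriv (deriv γ₂) x.1)
    refine ⟨s, ?_⟩
    rw [inducedConnection_apply, H.fderiv_fderiv_eq hx, ← hs]
    simp
  obtain ⟨s, hs⟩ := h1
  have h2 : fderiv ℝ (affineMetric f ξ) x (1, 0) (1, 0) (0, u) = 0 := by
    rw [← fderiv_clm_apply_const₂ hh]
    have hev : (fun z => affineMetric f ξ z (1, 0) (0, u)) =ᶠ[𝓝 x] fun _ => 0 := by
      filter_upwards [H.eventually_mem hx] with z hz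
      rw [H.affineMetric_eq hz]
      simp
    rw [hev.fderiv_eq]
    simp
  have h3 : fderiv ℝ (affineMetric f ξ) x (0, u) (1, 0) (1, 0) = 0 := by
    rw [← fderiv_clm_apply_const₂ hh]
    exact fderiv_eq_zero_of_indep_snd
      ((hh.clm_apply (differentiableAt_const _)).clm_apply (differentiableAt_const _))
      (H.eventually_indep_snd hx fun t ht y hy y' hy' => H.metric_axis_indep b ht hy hy') u
  rw [differenceTensor, map_sub, sub_apply, affineMetric_leviCivita hB, h2, h3, hs, map_smul,
    smul_apply, H.affineMetric_eq hx]
  simp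

theorem cubicForm_axis_sphere (H : IsSuspension ψ c γ₁ γ₂ f ξ J U) (hx : x ∈ J ×ˢ U) :
    ∃ k : ℝ, ∀ u v : V, affineMetric f ξ x (differenceTensor f ξ x (1, 0) (0, u)) (0, v) =
      k * affineMetric f ξ x (0, u) (0, v) := by
  have hB := H.blaschke x hx
  have hh := (contDiffAt_affineMetric (H.smooth x hx) (H.smooth_normal x hx)
    hB.transversal).differentiableAt (by simp)
  set m : ℝ → ℝ := fun t => γ₂ t * radialComp ψ f ξ (t, x.2) with hm
  have hm0 : m x.1 ≠ 0 := mul_ne_zero (H.scale_ne_zero hx) (H.radialComp_ne_zero hx)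
  have hmd : DifferentiableAt ℝ m x.1 :=
    ((H.smooth_snd _ hx.1).differentiableAt (by simp)).mul
      (fderiv_inl_eq_deriv (H.differentiableAt_radialComp hx)).differentiableAt
  refine ⟨deriv γ₂ x.1 / γ₂ x.1 - (1 / 2) * (deriv m x.1 / m x.1), fun u v => ?_⟩
  have h1 : inducedConnection f ξ x (1, 0) (0, u) = (deriv γ₂ x.1 / γ₂ x.1) • ((0 : ℝ), u) := by
    rw [inducedConnection_apply, H.fderiv_fderiv_eq hx]
    simp [H.incl_fderiv_eq hx, tangentialPart_fderiv hB.transversal, smul_smul, div_eq_mul_inv]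
  have h2 : ∀ w u : V, fderiv ℝ (affineMetric f ξ) x (0, w) (1, 0) (0, u) = 0 := by
    intro w u
    rw [← fderiv_clm_apply_const₂ hh]
    have hev : (fun z => affineMetric f ξ z (1, 0) (0, u)) =ᶠ[𝓝 x] fun _ => 0 := by
      filter_upwards [H.eventually_mem hx] with z hz
      rw [H.affineMetric_eq hz]
      simp
    rw [hev.fderiv_eq]
    simp
  have h3 : fderiv ℝ (affineMetric f ξ) x (1, 0) (0, u) (0, v) =
      (deriv m x.1 / m x.1) * affineMetric f ξ x (0, u) (0, v) := by
    rw [← fderiv_clm_apply_const₂ hh]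
    have hd := fderiv_inl_eq_deriv (g := fun z => affineMetric f ξ z (0, u) (0, v)) (x := x)
      ((hh.clm_apply (differentiableAt_const _)).clm_apply (differentiableAt_const _))
    have hev : (fun t => affineMetric f ξ (t, x.2) (0, u) (0, v)) =ᶠ[𝓝 x.1]
        fun t => m t * (-c * affineMetric ψ (fun z => -c • ψ z) x.2 u v) := by
      filter_upwards [H.isOpen_left.mem_nhds hx.1] with t ht
      rw [H.affineMetric_eq (x := (t, x.2)) ⟨ht, hx.2⟩]
      simp [hm]
      ring
    have he := hev.self_of_nhds
    simp only at he
    rw [hd.unique ((hmd.hasDerivAt.mul_const _).congr_of_eventuallyEq hev), he]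
    field_simp
  rw [differenceTensor, map_sub, sub_apply, affineMetric_leviCivita hB, h1, h3, h2, h2, map_smul,
    smul_apply, smul_eq_mul]
  ring

end IsSuspension

section Equivariance

variable {E : Type*} [AddCommGroup E] [Module ℝ E] (e : Module.Basis (Fin 3) ℝ E)

theorem toLin_rotation_zero (θ : ℝ) : Matrix.toLin e e (rotation θ).1 (e 0) = e 0 := by
  rw [Matrix.toLin_self]
  simp [rotation, Fin.sum_univ_three]

theorem toLin_rotation_one (θ : ℝ) :
    Matrix.toLin e e (rotation θ).1 (e 1) = Real.cos θ • e 1 + Real.sin θ • e 2 := by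
  rw [Matrix.toLin_self]
  simp [rotation, Fin.sum_univ_three]

theorem toLin_rotation_two (θ : ℝ) :
    Matrix.toLin e e (rotation θ).1 (e 2) = -Real.sin θ • e 1 + Real.cos θ • e 2 := by
  rw [Matrix.toLin_self]
  simp [rotation, Fin.sum_univ_three]

theorem cos_two_pi_div_three : Real.cos (2 * Real.pi / 3) = -(1 / 2) := by
  rw [show 2 * Real.pi / 3 = Real.pi - Real.pi / 3 by ring, Real.cos_pi_sub, Real.cos_pi_div_three]

theorem sin_sq_two_pi_div_three : Real.sin (2 * Real.pi / 3) ^ 2 = 3 / 4 := by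
  have h := Real.sin_sq_add_cos_sq (2 * Real.pi / 3)
  rw [cos_two_pi_div_three] at h
  linarith

theorem rotation_preserves_form {e : Module.Basis (Fin 3) ℝ E} (B : E →ₗ[ℝ] E →ₗ[ℝ] ℝ)
    (hB : ∀ i j, B (e i) (e j) = if i = j then 1 else 0) (θ : ℝ) (X Y : E) :
    B (Matrix.toLin e e (rotation θ).1 X) (Matrix.toLin e e (rotation θ).1 Y) = B X Y := by
  set L := Matrix.toLin e e (rotation θ).1 with hL
  suffices h : B.compl₁₂ L L = B from LinearMap.congr_fun₂ h X Y
  have hcs := Real.sin_sq_add_cos_sq θ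
  have l0 : L (e 0) = e 0 := toLin_rotation_zero e θ
  have l1 : L (e 1) = _ := toLin_rotation_one e θ
  have l2 : L (e 2) = _ := toLin_rotation_two e θ
  clear_value L
  refine e.ext fun i => e.ext fun j => ?_
  fin_cases i <;> fin_cases j <;>
    simp [l0, l1, l2, hB] <;> linarith

/-- A symmetric product of this shape is `κ · conj (z w)` on the plane orthogonal to `e 0`, up to
terms that are invariant under all rotations of that plane. -/
theorem rotation_commutes_product {e : Module.Basis (Fin 3) ℝ E} (K : E →ₗ[ℝ] E →ₗ[ℝ] E)
    (hK : ∀ X Y, K X Y = K Y X) {k₁ k₂ k₃ a b : ℝ} (h00 : K (e 0) (e 0) = k₁ • e 0)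
    (h01 : K (e 0) (e 1) = k₂ • e 1) (h02 : K (e 0) (e 2) = k₂ • e 2)
    (h11 : K (e 1) (e 1) = k₃ • e 0 + a • e 1 + b • e 2)
    (h12 : K (e 1) (e 2) = b • e 1 - a • e 2)
    (h22 : K (e 2) (e 2) = k₃ • e 0 - a • e 1 - b • e 2) (X Y : E) :
    K (Matrix.toLin e e (rotation (2 * Real.pi / 3)).1 X)
        (Matrix.toLin e e (rotation (2 * Real.pi / 3)).1 Y) =
      Matrix.toLin e e (rotation (2 * Real.pi / 3)).1 (K X Y) := by
  set L := Matrix.toLin e e (rotation (2 * Real.pi / 3)).1 with hL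
  suffices h : K.compl₁₂ L L = K.compr₂ L from LinearMap.congr_fun₂ h X Y
  have hs := sin_sq_two_pi_div_three
  have h10 := (hK (e 1) (e 0)).trans h01
  have h20 := (hK (e 2) (e 0)).trans h02
  have h21 := (hK (e 2) (e 1)).trans h12
  have l0 := toLin_rotation_zero e (2 * Real.pi / 3)
  have l1 := toLin_rotation_one e (2 * Real.pi / 3)
  have l2 := toLin_rotation_two e (2 * Real.pi / 3)
  rw [← hL, cos_two_pi_div_three] at l1 l2
  rw [← hL] at l0
  set s := Real.sin (2 * Real.pi / 3)
  clear_value L s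
  refine e.ext fun i => e.ext fun j => ?_
  fin_cases i <;> fin_cases j <;>
    simp only [Fin.zero_eta, Fin.mk_one, Fin.reduceFinMk, LinearMap.compl₁₂_apply,
      LinearMap.compr₂_apply, l0, l1, l2, map_add, map_sub, map_smul, LinearMap.add_apply,
      LinearMap.smul_apply, h00, h01, h02, h10, h11, h12, h20, h21, h22] <;>
    match_scalars <;> clear * - hs <;> grind

theorem symmetries_of_mem_zpowers {n : ℕ} {e : Module.Basis (Fin n) ℝ E} {h : E → E → ℝ}
    {K : E → E → E} {S : E → E} {g₀ g : Matrix.specialOrthogonalGroup (Fin n) ℝ}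
    (h₀ : ∀ X Y : E, h (Matrix.toLin e e g₀.1 X) (Matrix.toLin e e g₀.1 Y) = h X Y ∧
        K (Matrix.toLin e e g₀.1 X) (Matrix.toLin e e g₀.1 Y) = Matrix.toLin e e g₀.1 (K X Y) ∧
        S (Matrix.toLin e e g₀.1 X) = Matrix.toLin e e g₀.1 (S X))
    (hg : g ∈ Subgroup.zpowers g₀) (X Y : E) :
    h (Matrix.toLin e e g.1 X) (Matrix.toLin e e g.1 Y) = h X Y ∧
      K (Matrix.toLin e e g.1 X) (Matrix.toLin e e g.1 Y) = Matrix.toLin e e g.1 (K X Y) ∧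
      S (Matrix.toLin e e g.1 X) = Matrix.toLin e e g.1 (S X) := by
  have hmul : ∀ (g g' : Matrix.specialOrthogonalGroup (Fin n) ℝ) (Z : E),
      Matrix.toLin e e (g * g').1 Z = Matrix.toLin e e g.1 (Matrix.toLin e e g'.1 Z) := by
    intro g g' Z
    rw [show (g * g').1 = g.1 * g'.1 from rfl, Matrix.toLin_mul e e e]
    rfl
  have hone : ∀ Z : E,
      Matrix.toLin e e (1 : Matrix.specialOrthogonalGroup (Fin n) ℝ).1 Z = Z := by
    intro Z
    rw [show (1 : Matrix.specialOrthogonalGroup (Fin n) ℝ).1 = 1 from rfl, Matrix.toLin_one]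
    rfl
  rw [Subgroup.zpowers_eq_closure] at hg
  induction hg using Subgroup.closure_induction generalizing X Y with
  | mem g hg =>
    rw [Set.mem_singleton_iff] at hg
    subst hg
    exact h₀ X Y
  | one => simp only [hone, and_self]
  | mul g g' _ _ ih ih' =>
    simp only [hmul]
    refine ⟨?_, ?_, ?_⟩
    · rw [(ih _ _).1, (ih' _ _).1]
    · rw [(ih _ _).2.1, (ih' _ _).2.1]
    · rw [(ih _ X).2.2, (ih' _ X).2.2]
  | inv g _ ih =>
    have hr : ∀ Z, Matrix.toLin e e g.1 (Matrix.toLin e e (g⁻¹).1 Z) = Z := fun Z => by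
      rw [← hmul, mul_inv_cancel, hone]
    have hl : ∀ Z, Matrix.toLin e e (g⁻¹).1 (Matrix.toLin e e g.1 Z) = Z := fun Z => by
      rw [← hmul, inv_mul_cancel, hone]
    have hi := ih (Matrix.toLin e e (g⁻¹).1 X) (Matrix.toLin e e (g⁻¹).1 Y)
    simp only [hr] at hi
    refine ⟨hi.1.symm, ?_, ?_⟩
    · rw [hi.2.1, hl]
    · rw [hi.2.2, hl]

/-- A positive definite symmetric form on a plane has an orthonormal basis. -/
theorem exists_orthonormal_basis {V : Type*} [AddCommGroup V] [Module ℝ V]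
    [FiniteDimensional ℝ V] (hV : Module.finrank ℝ V = 2) (B : LinearMap.BilinForm ℝ V)
    (hsymm : ∀ u v, B u v = B v u) (hpos : ∀ u, u ≠ 0 → 0 < B u u) :
    ∃ b : Module.Basis (Fin 2) ℝ V, ∀ i j, B (b i) (b j) = if i = j then 1 else 0 := by
  obtain ⟨v, hv⟩ := LinearMap.BilinForm.exists_orthogonal_basis (B := B) ⟨fun u v => hsymm u v⟩
  have hp : ∀ i, 0 < B (v i) (v i) := fun i => hpos _ (v.ne_zero i)
  have hu : ∀ i, IsUnit ((√(B (v i) (v i)))⁻¹) := fun i =>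
    (inv_ne_zero (Real.sqrt_pos.2 (hp i)).ne').isUnit
  refine ⟨(v.isUnitSMul hu).reindex (finCongr hV), fun i j => ?_⟩
  obtain ⟨i, rfl⟩ := (finCongr hV).surjective i
  obtain ⟨j, rfl⟩ := (finCongr hV).surjective j
  simp only [Module.Basis.reindex_apply, Equiv.symm_apply_apply, Module.Basis.isUnitSMul_apply,
    map_smul, LinearMap.smul_apply, smul_eq_mul, EmbeddingLike.apply_eq_iff_eq]
  split_ifs with hij
  · subst hij
    rw [← mul_assoc, ← mul_inv, Real.mul_self_sqrt (hp i).le, inv_mul_cancel₀ (hp i).ne']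
  · rw [hv hij]
    simp

end Equivariance

namespace IsSuspension

variable {V : Type*} [NormedAddCommGroup V] [NormedSpace ℝ V] [FiniteDimensional ℝ V]
  {ψ : V → (Fin 3 → ℝ)} {c : ℝ} {γ₁ γ₂ : ℝ → ℝ} {f ξ : ℝ × V → (Fin 4 → ℝ)}
  {J : Set ℝ} {U : Set V} {x : ℝ × V}

theorem exists_orthonormal_frame (H : IsSuspension ψ c γ₁ γ₂ f ξ J U) (hx : x ∈ J ×ˢ U)
    (hV : Module.finrank ℝ V = 2) :
    ∃ (a : ℝˣ) (b : Module.Basis (Fin 2) ℝ V), ∀ i j,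
      affineMetric f ξ x (prodBasis a b i) (prodBasis a b j) = if i = j then 1 else 0 := by
  have : Nontrivial V := Module.nontrivial_of_finrank_pos (R := ℝ) (by omega)
  let B : LinearMap.BilinForm ℝ V := LinearMap.mk₂ ℝ
    (fun u v => affineMetric f ξ x (0, u) (0, v))
    (fun u v w => by rw [← add_apply, ← map_add, Prod.mk_add_mk, add_zero])
    (fun r u v => by rw [← smul_apply, ← map_smul, Prod.smul_mk, smul_zero])
    (fun u v w => by rw [← map_add, Prod.mk_add_mk, add_zero])
    (fun r u v => by rw [← map_smul, Prod.smul_mk, smul_zero])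
  obtain ⟨b, hb⟩ := exists_orthonormal_basis hV B
    (fun u v => affineMetric_symm (H.smooth x hx) _ _)
    (fun u hu => H.pos x hx (0, u) (by simp [hu]))
  have hb' : ∀ i j, affineMetric f ξ x (0, b i) (0, b j) = if i = j then 1 else 0 := hb
  have hA := H.pos x hx (1, 0) (by simp)
  set A := affineMetric f ξ x (1, 0) (1, 0) with hAdef
  have hs := Real.sqrt_pos.2 hA
  refine ⟨Units.mk0 (√A)⁻¹ (inv_ne_zero hs.ne'), b, fun i j => ?_⟩
  have h0 : prodBasis (Units.mk0 (√A)⁻¹ (inv_ne_zero hs.ne')) b 0 =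
      (√A)⁻¹ • ((1 : ℝ), (0 : V)) := by simp [prodBasis_zero]
  have h1 : ∀ u : V, affineMetric f ξ x (1, 0) (0, u) = 0 := fun u => by
    rw [H.affineMetric_eq hx]
    simp
  have h2 : ∀ u : V, affineMetric f ξ x (0, u) (1, 0) = 0 := fun u => by
    rw [affineMetric_symm (H.smooth x hx), h1]
  have h3 : (√A)⁻¹ * ((√A)⁻¹ * A) = 1 := by
    rw [← mul_assoc, ← mul_inv, Real.mul_self_sqrt hA.le, inv_mul_cancel₀ hA.ne']
  fin_cases i <;> fin_cases j <;>
    simp [-Prod.smul_mk, prodBasis_one, prodBasis_two, hb', h0, h1, h2, h3, ← hAdef]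

theorem admits_rotation (H : IsSuspension ψ c γ₁ γ₂ f ξ J U) (hx : x ∈ J ×ˢ U)
    (hV : Module.finrank ℝ V = 2) :
    ∃ e : Module.Basis (Fin 3) ℝ (ℝ × V),
      (∀ i j, affineMetric f ξ x (e i) (e j) = if i = j then 1 else 0) ∧
      ∀ X Y : ℝ × V, let L := Matrix.toLin e e (rotation (2 * Real.pi / 3)).1
        affineMetric f ξ x (L X) (L Y) = affineMetric f ξ x X Y ∧
        differenceTensor f ξ x (L X) (L Y) = L (differenceTensor f ξ x X Y) ∧
        shapeOperator f ξ x (L X) = L (shapeOperator f ξ x X) := by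
  have : Nontrivial V := Module.nontrivial_of_finrank_pos (R := ℝ) (by omega)
  obtain ⟨a, b, hab⟩ := H.exists_orthonormal_frame hx hV
  have hf := H.smooth x hx
  have hξ := H.smooth_normal x hx
  have hB := H.eventually_blaschke hx
  set e := prodBasis a b with he
  have e0 : e 0 = (a : ℝ) • ((1 : ℝ), (0 : V)) := by rw [he, prodBasis_zero]; simp
  have e1 : e 1 = ((0 : ℝ), b 0) := prodBasis_one a b
  have e2 : e 2 = ((0 : ℝ), b 1) := prodBasis_two a b
  let K : (ℝ × V) →ₗ[ℝ] (ℝ × V) →ₗ[ℝ] (ℝ × V) := LinearMap.mk₂ ℝ (differenceTensor f ξ x)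
    (fun u v w => by
      rw [differenceTensor_symm hf hξ hB, differenceTensor_add_right,
        differenceTensor_symm hf hξ hB w u, differenceTensor_symm hf hξ hB w v])
    (fun r u v => by
      rw [differenceTensor_symm hf hξ hB, differenceTensor_smul_right,
        differenceTensor_symm hf hξ hB v u])
    (fun u v w => differenceTensor_add_right u v w)
    (fun r u v => differenceTensor_smul_right u r v)
  have hKsymm : ∀ X Y, K X Y = K Y X := differenceTensor_symm hf hξ hB
  let C : Fin 3 → Fin 3 → Fin 3 → ℝ := fun i j k => affineMetric f ξ x (K (e i) (e j)) (e k)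
  have hexp : ∀ i j, K (e i) (e j) = C i j 0 • e 0 + C i j 1 • e 1 + C i j 2 • e 2 := by
    intro i j
    conv_lhs => rw [← e.sum_repr (K (e i) (e j))]
    simp only [Fin.sum_univ_three, ← affineMetric_eq_repr hab, C]
  have hl : ∀ i j k, C i j k = C j i k := fun i j k => by
    simp only [C, hKsymm (e i) (e j)]
  have hr : ∀ i j k, C i j k = C i k j := fun i j k => cubicForm_symm_right hf hξ hB _ _ _
  have htr : ∀ i, C i 0 0 + C i 1 1 + C i 2 2 = 0 := fun i => by
    have h := apolarity hf hξ hB hab (e i)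
    rwa [Fin.sum_univ_three] at h
  have hK0 : ∀ Y, K (e 0) Y = (a : ℝ) • K (1, 0) Y := fun Y => by
    rw [e0, map_smul, LinearMap.smul_apply]
  have h00 : ∀ u : V, affineMetric f ξ x (K (e 0) (e 0)) (0, u) = 0 := by
    intro u
    have h := H.cubicForm_axis_axis b hx u
    change affineMetric f ξ x (K (1, 0) (1, 0)) (0, u) = 0 at h
    rw [hK0, e0, map_smul, map_smul, map_smul, smul_apply, smul_apply, h, smul_zero, smul_zero]
  have C001 : C 0 0 1 = 0 := by simp only [C]; rw [e1, h00]
  have C002 : C 0 0 2 = 0 := by simp only [C]; rw [e2, h00]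
  obtain ⟨k, hk⟩ := H.cubicForm_axis_sphere hx
  have h0k : ∀ u v : V, affineMetric f ξ x (K (e 0) (0, u)) (0, v) =
      (a : ℝ) * k * affineMetric f ξ x (0, u) (0, v) := by
    intro u v
    have h := hk u v
    change affineMetric f ξ x (K (1, 0) (0, u)) (0, v) = _ at h
    rw [hK0, map_smul, smul_apply, h, smul_eq_mul, mul_assoc]
  have C011 : C 0 1 1 = a * k := by
    simp only [C]
    rw [e1, h0k, ← e1, hab]
    simp
  have C012 : C 0 1 2 = 0 := by
    simp only [C]
    rw [e1, e2, h0k, ← e1, ← e2, hab]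
    simp
  have C022 : C 0 2 2 = a * k := by
    simp only [C]
    rw [e2, h0k, ← e2, hab]
    simp
  have C010 : C 0 1 0 = 0 := (hr 0 1 0).trans C001
  have C020 : C 0 2 0 = 0 := (hr 0 2 0).trans C002
  have C021 : C 0 2 1 = 0 := (hr 0 2 1).trans C012
  have C110 : C 1 1 0 = a * k := ((hr 1 1 0).trans (hl 1 0 1)).trans C011
  have C120 : C 1 2 0 = 0 := ((hr 1 2 0).trans (hl 1 0 2)).trans C012
  have C220 : C 2 2 0 = a * k := ((hr 2 2 0).trans (hl 2 0 2)).trans C022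
  have C121 : C 1 2 1 = C 1 1 2 := hr 1 2 1
  have C122 : C 1 2 2 = -C 1 1 1 := by
    have h := htr 1
    rw [hl 1 0 0, C010] at h
    linarith
  have C221 : C 2 2 1 = -C 1 1 1 := by rw [hr, hl, C122]
  have C222 : C 2 2 2 = -C 1 1 2 := by
    have h := htr 2
    rw [hl 2 0 0, C020, hl 2 1 1, C121] at h
    linarith
  obtain ⟨s, hs⟩ := H.shapeOperator_axis b hx
  obtain ⟨s', hs'⟩ := H.shapeOperator_sphere b hx
  refine ⟨e, hab, fun X Y => ?_⟩
  intro L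
  refine ⟨?_, ?_, ?_⟩
  · exact rotation_preserves_form (e := e) ((ContinuousLinearMap.coeLM ℝ).comp
      (affineMetric f ξ x : (ℝ × V) →ₗ[ℝ] (ℝ × V) →L[ℝ] ℝ)) hab _ X Y
  · refine rotation_commutes_product (e := e) K hKsymm (k₁ := C 0 0 0) (k₂ := a * k)
      (k₃ := a * k) (a := C 1 1 1) (b := C 1 1 2) ?_ ?_ ?_ ?_ ?_ ?_ X Y
    · rw [hexp, C001, C002]; module
    · rw [hexp, C010, C011, C012]; module
    · rw [hexp, C020, C021, C022]; module
    · rw [hexp, C110]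
    · rw [hexp, C120, C121, C122]; module
    · rw [hexp, C220, C221, C222]; module
  · have hS0 : shapeOperator f ξ x (e 0) = s • e 0 := by rw [e0, map_smul, hs, smul_comm]
    have hS1 : shapeOperator f ξ x (e 1) = s' • e 1 := by rw [e1, hs']
    have hS2 : shapeOperator f ξ x (e 2) = s' • e 2 := by rw [e2, hs']
    suffices h : (shapeOperator f ξ x : (ℝ × V) →ₗ[ℝ] (ℝ × V)) ∘ₗ L =
        L ∘ₗ (shapeOperator f ξ x : (ℝ × V) →ₗ[ℝ] (ℝ × V)) from LinearMap.congr_fun h X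
    have l0 : L (e 0) = e 0 := toLin_rotation_zero e _
    have l1 : L (e 1) = _ := toLin_rotation_one e _
    have l2 : L (e 2) = _ := toLin_rotation_two e _
    refine e.ext fun i => ?_
    fin_cases i <;>
      simp only [Fin.zero_eta, Fin.mk_one, Fin.reduceFinMk, LinearMap.comp_apply,
        ContinuousLinearMap.coe_coe, map_add, map_smul, l0, l1, l2, hS0, hS1, hS2] <;>
      module

end IsSuspension

section Charts

variable {N : Type*} [TopologicalSpace N] [ChartedSpace (EuclideanSpace ℝ (Fin 2)) N]

theorem inChart_prod_apply {W : Type*} (F : ℝ × N → W) (p : ℝ × N)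
    (z : ℝ × EuclideanSpace ℝ (Fin 2)) :
    inChart (𝓘(ℝ, ℝ).prod 𝓘(ℝ, EuclideanSpace ℝ (Fin 2))) F p z =
      F (z.1, (extChartAt 𝓘(ℝ, EuclideanSpace ℝ (Fin 2)) p.2).symm z.2) := by
  rw [inChart, extChartAt_prod, extChartAt_model_space_eq_id]
  rfl

theorem mem_extChartAt_prod_target (p : ℝ × N) (z : ℝ × EuclideanSpace ℝ (Fin 2)) :
    z ∈ (extChartAt (𝓘(ℝ, ℝ).prod 𝓘(ℝ, EuclideanSpace ℝ (Fin 2))) p).target ↔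
      z.2 ∈ (extChartAt 𝓘(ℝ, EuclideanSpace ℝ (Fin 2)) p.2).target := by
  rw [extChartAt_prod, PartialEquiv.prod_target, extChartAt_model_space_eq_id]
  simp

theorem contDiffAt_inChart {E : Type*} [NormedAddCommGroup E] [NormedSpace ℝ E] {H : Type*}
    [TopologicalSpace H] {I : ModelWithCorners ℝ E H} {M : Type*} [TopologicalSpace M]
    [ChartedSpace H M] [I.Boundaryless] [IsManifold I ∞ M] {W : Type*} [NormedAddCommGroup W]
    [NormedSpace ℝ W] {F : M → W} {Ω : Set M} (hΩ : IsOpen Ω) (hF : ContMDiffOn I 𝓘(ℝ, W) ∞ F Ω)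
    (p : M) {z : E} (hz : z ∈ (extChartAt I p).target) (hz' : (extChartAt I p).symm z ∈ Ω) :
    ContDiffAt ℝ ∞ (inChart I F p) z := by
  have h1 : ContMDiffAt 𝓘(ℝ, E) I ∞ (extChartAt I p).symm z :=
    (contMDiffOn_extChartAt_symm p).contMDiffAt ((isOpen_extChartAt_target p).mem_nhds hz)
  exact contMDiffAt_iff_contDiffAt.1
    (ContMDiffAt.comp z (hF.contMDiffAt (hΩ.mem_nhds hz')) h1)

end Charts

end AffineHypersurface

open AffineHypersurface in
theorem theorem4p2
    {N : Type*} [TopologicalSpace N] [ChartedSpace (EuclideanSpace ℝ (Fin 2)) N]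
    [IsManifold 𝓘(ℝ, EuclideanSpace ℝ (Fin 2)) ∞ N]
    -- the affine sphere, elliptic (`c = 1`) or hyperbolic (`c = -1`)
    (φ ν : N → (Fin 3 → ℝ)) (c : ℝ)
    (hφ : IsProperAffineSphere 𝓘(ℝ, EuclideanSpace ℝ (Fin 2)) φ ν c) (hc : |c| = 1)
    -- the plane curve, on an open interval
    (J : Set ℝ) (hJ : IsOpen J) (hJ' : J.OrdConnected) (γ₁ γ₂ : ℝ → ℝ)
    (hγ₁ : ContDiffOn ℝ ∞ γ₁ J) (hγ₂ : ContDiffOn ℝ ∞ γ₂ J)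
    -- the hypersurface `F` on `J × N`, with its affine normal `ξ`
    (F ξ : ℝ × N → (Fin 4 → ℝ))
    (hF : ∀ t ∈ J, ∀ x : N, F (t, x) = Matrix.vecCons (γ₁ t) (γ₂ t • φ x))
    (hpos : IsPositiveDefinite (𝓘(ℝ, ℝ).prod 𝓘(ℝ, EuclideanSpace ℝ (Fin 2))) F ξ
      (J ×ˢ Set.univ)) :
    AdmitsPointwiseSymmetry (𝓘(ℝ, ℝ).prod 𝓘(ℝ, EuclideanSpace ℝ (Fin 2))) F ξ
        (J ×ˢ Set.univ) groupZ3 ∨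
      AdmitsPointwiseSymmetry (𝓘(ℝ, ℝ).prod 𝓘(ℝ, EuclideanSpace ℝ (Fin 2))) F ξ
        (J ×ˢ Set.univ) groupSO2 := by
  refine Or.inl fun p hp => ?_
  have hν : ν = fun q => -c • φ q := by
    funext q
    have hc2 : c⁻¹ = c := by
      rcases eq_or_eq_neg_of_abs_eq hc with h | h <;> rw [h] <;> norm_num
    have hcc : c * c = 1 := by
      nth_rewrite 1 [← hc2]
      exact inv_mul_cancel₀ hφ.ne_zero
    have h1 := congrArg (c • ·) (hφ.centre q)
    simp only [smul_add, smul_smul, hc2, hcc, one_smul, smul_zero] at h1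
    rw [neg_smul]
    exact eq_neg_of_add_eq_zero_right h1
  have hΩ : IsOpen (J ×ˢ (Set.univ : Set N)) := hJ.prod isOpen_univ
  have htarget : ∀ z : ℝ × EuclideanSpace ℝ (Fin 2),
      z ∈ J ×ˢ (extChartAt 𝓘(ℝ, EuclideanSpace ℝ (Fin 2)) p.2).target →
      z ∈ (extChartAt (𝓘(ℝ, ℝ).prod 𝓘(ℝ, EuclideanSpace ℝ (Fin 2))) p).target ∧
      (extChartAt (𝓘(ℝ, ℝ).prod 𝓘(ℝ, EuclideanSpace ℝ (Fin 2))) p).symm z ∈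
        J ×ˢ (Set.univ : Set N) := by
    intro z hz
    refine ⟨(mem_extChartAt_prod_target p z).2 hz.2, ?_⟩
    rw [extChartAt_prod, extChartAt_model_space_eq_id]
    exact ⟨hz.1, Set.mem_univ _⟩
  have H : IsSuspension (inChart 𝓘(ℝ, EuclideanSpace ℝ (Fin 2)) φ p.2) c γ₁ γ₂
      (inChart (𝓘(ℝ, ℝ).prod 𝓘(ℝ, EuclideanSpace ℝ (Fin 2))) F p)
      (inChart (𝓘(ℝ, ℝ).prod 𝓘(ℝ, EuclideanSpace ℝ (Fin 2))) ξ p) J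
      (extChartAt 𝓘(ℝ, EuclideanSpace ℝ (Fin 2)) p.2).target :=
    { isOpen_left := hJ
      isOpen_right := isOpen_extChartAt_target p.2
      abs_eq_one := hc
      smooth_sphere := fun y hy =>
        contDiffAt_inChart isOpen_univ hφ.smooth p.2 hy (Set.mem_univ _)
      blaschke_sphere := fun y hy => by
        have h := hφ.blaschke p.2 y hy (Set.mem_univ _)
        rw [hν] at h
        exact h
      smooth_fst := fun t ht => hγ₁.contDiffAt (hJ.mem_nhds ht)
      smooth_snd := fun t ht => hγ₂.contDiffAt (hJ.mem_nhds ht)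
      eq := fun t ht y _ => by
        rw [inChart_prod_apply, hF t ht]
        rfl
      smooth := fun z hz =>
        contDiffAt_inChart hΩ hpos.smooth p (htarget z hz).1 (htarget z hz).2
      smooth_normal := fun z hz =>
        contDiffAt_inChart hΩ hpos.smooth_normal p (htarget z hz).1 (htarget z hz).2
      blaschke := fun z hz => hpos.blaschke p z (htarget z hz).1 (htarget z hz).2
      pos := fun z hz => hpos.pos p z (htarget z hz).1 (htarget z hz).2 }
  have hx : extChartAt (𝓘(ℝ, ℝ).prod 𝓘(ℝ, EuclideanSpace ℝ (Fin 2))) p p ∈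
      J ×ˢ (extChartAt 𝓘(ℝ, EuclideanSpace ℝ (Fin 2)) p.2).target := by
    refine ⟨?_, (mem_extChartAt_prod_target p _).1 (mem_extChartAt_target p)⟩
    rw [extChartAt_prod, extChartAt_model_space_eq_id]
    exact hp.1
  obtain ⟨e, he, hsym⟩ := H.admits_rotation hx (by simp)
  exact ⟨e, he, fun g hg X Y => symmetries_of_mem_zpowers
    (h := fun X Y => affineMetric _ _ _ X Y) hsym hg X Y⟩
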